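/- **Setting.** Let $p\ge 1$, let $\Gamma\subset\mathbb R^3$ be an embedded surface of class $C^{p+1}$ (without boundary points: near each of its points, $\Gamma$ is the regular zero set of a real $C^{p+1}$ function), and let $K\subseteq\Gamma$ be compact ($K=\Gamma$ if $\Gamma$ is compact). Fix $s\in[1,\infty]$ and constants $R,C_x,C_m,C_n,\kappa,\Lambda,M$. Let $T$ be the closed triangle with vertices $(0,0),(1,0),(0,1)$, and let $n=(p+1)(p+2)/2$. For a length $h>0$ consider the following data. *Input mesh.* Finitely many mesh vertices $X_v\in\mathbb R^3$, among them the three corners $X_{v_1},X_{v_2},X_{v_3}$ of a triangle, with unit vectors $m_v$ (approximate normals for the local frames) and vectors $n_v$ (Hermite normals). There are points $y_v\in K$ with $\|X_v-y_v\|\le C_xh^{p+1}$, and each $m_v$ is within $C_mh$ of a unit normal of $\Gamma$ at $y_v$. The $m_{v_j}$ are consistently oriented: $\langle m_{v_j},m_{v_k}\rangle>0$. *Element.* Nodes $\xi_1,\dots,\xi_n\in T$ and their Lagrange basis $N_1,\dots,N_n$ (polynomials of degree $\le p$ in two variables with $N_i(\xi_j)=\delta_{ij}$). The interpolation is stable: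 $\sum_i|N_i(\xi)|\le\Lambda$ for $\xi\in T$. *Nodes.* Each $x_i\in\mathbb R^3$ is either a corner of the triangle or $x_i=\Pi(p_i)$, the degree-$p$ CMF or H-CMF reconstruction at an intermediate point $p_i$, as follows. Let $(\lambda_1,\lambda_2,\lambda_3)$ be the barycentric coordinates of $\xi_i$ in $T$, let $m=\sum_j\lambda_jm_{v_j}/\|\sum_j\lambda_jm_{v_j}\|$, and complete $m$ to an orthonormal frame $(s_0,t_0,m)$. Choose a finite stencil $S$ of mesh vertices such that all $X_v$, $v\in S$, and the three corners are within $Rh$ of $p_i$, and choose real weights $\omega_v$. Let $(u_v,v_v,w_v)$ be the coordinates of $X_v-p_i$ in the frame, and let $\mu_v=u_v/h$, $\nu_v=v_v/h$. - CMF: the coefficients $(c_{jk})_{j+k\le p}$ solve, in the least squares sense with weights $\omega_v$, the equations $\sum_{j+k\le p}c_{jk}\mu_v^j\nu_v^k\approx w_v$, $v\in S$. - H-CMF: with $(\alpha_v,\beta_v,\gamma_v)$ the components of $n_v$ in the frame, one adds the equations $\sum jc_{jk}\mu_v^{j-1}\nu_v^k\approx-h\alpha_v/\gamma_v$ and $\sum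 kc_{jk}\mu_v^j\nu_v^{k-1}\approx-h\beta_v/\gamma_v$, $v\in S$, with the same weights $\omega_v$. In this case each $n_v$, $v\in S$, is within $C_nh^p$ of a unit normal of $\Gamma$ at $y_v$. In both cases $\Pi(p_i)=p_i+c_{00}\,m$. The weighted matrix $A$ of the rescaled system has full column rank, and its condition number $\|A\|\,\|A^+\|$ in the $\ell^s$ operator norm is at most $\kappa$. *Smooth parameterization.* Let $x(\zeta)=\sum_iN_i(\zeta/h)\,x_i$ for $\zeta\in hT$; that is, the natural coordinates $\zeta$ are measured at the length scale $h$ of the stencil. All derivatives of $x$ with respect to $\zeta$ of orders $1,\dots,p+1$ are bounded by $M$ on $hT$. **Theorem.** There are constants $C$ and $h_0>0$, depending only on $\Gamma,K,p,s,R,C_x,C_m,C_n,\kappa,\Lambda,M$, such that for every $0<h\le h_0$ and all data as above, every point $x(\zeta)$, $\zeta\in hT$, of the element is within distance $C\,h^{p+1}$ of a point of $\Gamma$. In other words, the parametric surface approximates $\Gamma$ to $O(h^{p+1})$. -/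

import Mathlib

open scoped ENNReal RealInnerProductSpace

noncomputable section

/-- The natural coordinates `(ξ, η)`, or local coordinates `(u, v)`. -/
abbrev Plane := EuclideanSpace ℝ (Fin 2)

/-- The ambient space of the surface. -/
abbrev Space := EuclideanSpace ℝ (Fin 3)

/-! ### Surfaces -/

/-- `Γ` is an embedded surface in `ℝ³` of class `C^k` (meant for `k ≥ 1`), without boundary points:
near each of its points it is the regular zero set of a real function of class `C^k`. -/
def IsSurfaceOfClass (k : ℕ) (Γ : Set Space) : Prop :=
  ∀ y ∈ Γ, ∃ (U : Set Space) (F : Space → ℝ), IsOpen U ∧ y ∈ U ∧ ContDiffOn ℝ k F U ∧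
    (∀ z ∈ U, fderiv ℝ F z ≠ 0) ∧ Γ ∩ U = {z ∈ U | F z = 0}

/-- `ν` is one of the two unit normals of `Γ` at `y`. -/
def IsUnitNormal (Γ : Set Space) (y ν : Space) : Prop :=
  ‖ν‖ = 1 ∧ ∀ τ ∈ tangentConeAt ℝ Γ y, ⟪ν, τ⟫ = 0

/-! ### Weighted least squares and conditioning -/

/-- Exponents `(j, k)` of the monomials `u ^ j * v ^ k` of total degree at most `p`. -/
abbrev MonoIdx (p : ℕ) := {a : Fin (p + 1) × Fin (p + 1) // a.1.val + a.2.val ≤ p}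

/-- The exponent `(0, 0)`. -/
def MonoIdx.zero (p : ℕ) : MonoIdx p := ⟨(0, 0), by simp⟩

/-- The pseudo-inverse `(Aᵀ A)⁻¹ Aᵀ` of a matrix with linearly independent columns. -/
def pseudoInverse {m n : Type} [Fintype m] [Fintype n] [DecidableEq n] (A : Matrix m n ℝ) :
    Matrix n m ℝ :=
  (A.transpose * A)⁻¹ * A.transpose

/-- The operator norm of a matrix with respect to the `ℓ^s` norms. -/
def lpOpNorm (s : ℝ≥0∞) [Fact (1 ≤ s)] {m n : Type} [Fintype m] [Fintype n] [DecidableEq n]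
    (A : Matrix m n ℝ) : ℝ :=
  ‖LinearMap.toContinuousLinearMap (Matrix.toLpLin s s A)‖

/-- The condition number `‖A‖ ‖A⁺‖` in the `ℓ^s` operator norm, for full column rank. -/
def condNumber (s : ℝ≥0∞) [Fact (1 ≤ s)] {m n : Type} [Fintype m] [Fintype n] [DecidableEq m]
    [DecidableEq n] (A : Matrix m n ℝ) : ℝ :=
  lpOpNorm s A * lpOpNorm s (pseudoInverse A)

/-- `A` has full column rank and condition number at most `κ`. -/
def WellConditioned (s : ℝ≥0∞) [Fact (1 ≤ s)] {m n : Type} [Fintype m] [Fintype n]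
    [DecidableEq m] [DecidableEq n] (κ : ℝ) (A : Matrix m n ℝ) : Prop :=
  LinearIndependent ℝ A.col ∧ condNumber s A ≤ κ

/-- `c` minimizes `‖Ω (V c - g)‖₂`, where `Ω = diag ω`. -/
def IsWeightedLeastSquares {m n : Type} [Fintype m] [Fintype n] (ω : m → ℝ) (V : Matrix m n ℝ)
    (g : m → ℝ) (c : n → ℝ) : Prop :=
  ∀ c' : n → ℝ, ∑ r, (ω r * (V.mulVec c r - g r)) ^ 2 ≤ ∑ r, (ω r * (V.mulVec c' r - g r)) ^ 2

/-! ### Local frames and the rescaled Vandermonde systems -/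

/-- A local `uvw` coordinate system: its origin and its three axes. -/
structure LocalFrame where
  origin : Space
  s : Space
  t : Space
  m : Space

namespace LocalFrame

/-- The axes are orthonormal. -/
def IsOrthonormal (Q : LocalFrame) : Prop := Orthonormal ℝ ![Q.s, Q.t, Q.m]

def u (Q : LocalFrame) (x : Space) : ℝ := ⟪Q.s, x - Q.origin⟫
def v (Q : LocalFrame) (x : Space) : ℝ := ⟪Q.t, x - Q.origin⟫
def w (Q : LocalFrame) (x : Space) : ℝ := ⟪Q.m, x - Q.origin⟫

variable {ι : Type} (Q : LocalFrame) (h : ℝ) (p : ℕ)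

/-- The rescaled generalized Vandermonde matrix of a point-based fitting of degree `p`:
monomials in `μ = u / h` and `ν = v / h`. -/
def pointMatrix (x : ι → Space) : Matrix ι (MonoIdx p) ℝ :=
  Matrix.of fun i a => (Q.u (x i) / h) ^ a.1.1.val * (Q.v (x i) / h) ^ a.1.2.val

/-- The rows of the `μ`-derivatives of the monomials. -/
def derivMatrixU (x : ι → Space) : Matrix ι (MonoIdx p) ℝ :=
  Matrix.of fun i a =>
    (a.1.1.val : ℝ) * (Q.u (x i) / h) ^ (a.1.1.val - 1) * (Q.v (x i) / h) ^ a.1.2.val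

/-- The rows of the `ν`-derivatives of the monomials. -/
def derivMatrixV (x : ι → Space) : Matrix ι (MonoIdx p) ℝ :=
  Matrix.of fun i a =>
    (a.1.2.val : ℝ) * (Q.u (x i) / h) ^ a.1.1.val * (Q.v (x i) / h) ^ (a.1.2.val - 1)

/-- The local heights, that is, the right-hand side of a point-based fitting. -/
def pointRhs (x : ι → Space) : ι → ℝ := fun i => Q.w (x i)

/-- The rescaled matrix of a Hermite-style fitting: one row for the position and two rows for
the normal of each point. -/
def hermiteMatrix (x : ι → Space) : Matrix (ι ⊕ (ι ⊕ ι)) (MonoIdx p) ℝ :=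
  Matrix.of (Sum.elim (Q.pointMatrix h p x)
    (Sum.elim (Q.derivMatrixU h p x) (Q.derivMatrixV h p x)))

/-- The rescaled right-hand side `(w, -h α / γ, -h β / γ)` of a Hermite-style fitting, where
`(α, β, γ)` are the components of the normal at each point in the local frame. -/
def hermiteRhs (x n : ι → Space) : ι ⊕ (ι ⊕ ι) → ℝ :=
  Sum.elim (Q.pointRhs x)
    (Sum.elim (fun i => -(h * ⟪Q.s, n i⟫ / ⟪Q.m, n i⟫)) (fun i => -(h * ⟪Q.t, n i⟫ / ⟪Q.m, n i⟫)))

end LocalFrame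

/-- The weights of a Hermite-style fitting: the three equations of a point share its weight. -/
def tripleWeight {ι : Type} (ω : ι → ℝ) : ι ⊕ (ι ⊕ ι) → ℝ := Sum.elim ω (Sum.elim ω ω)

/-! ### The input mesh around one triangle -/

/-- The closed reference triangle with vertices `(0, 0)`, `(1, 0)`, `(0, 1)`. -/
def refTriangle : Set Plane := {ξ | 0 ≤ ξ 0 ∧ 0 ≤ ξ 1 ∧ ξ 0 + ξ 1 ≤ 1}

/-- Barycentric coordinates in the reference triangle. -/
def baryCoord (ξ : Plane) : Fin 3 → ℝ := ![1 - ξ 0 - ξ 1, ξ 0, ξ 1]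

/-- The part of the input mesh that matters for one element: `N` mesh vertices with their
positions, the approximate unit normals `m` used for the frames, the normals `n` used as Hermite
data, and the corners of the triangle. -/
structure MeshPatch (N : ℕ) where
  pos : Fin N → Space
  m : Fin N → Space
  n : Fin N → Space
  tri : Fin 3 → Fin N

namespace MeshPatch

variable {N : ℕ} (P : MeshPatch N)

/-- The moving frame normal: the normalized barycentric average of the corner normals. -/
def avgNormal (ξ : Plane) : Space :=
  ‖∑ j, baryCoord ξ j • P.m (P.tri j)‖⁻¹ • ∑ j, baryCoord ξ j • P.m (P.tri j)

/-- The vertices are within `Cx * h ^ (p + 1)` of points `y` of `K ⊆ Γ`, the unit vectors `m` are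
within `Cm * h` of unit normals of `Γ` there, and the orientations of the vectors `m` at the
corners of the triangle agree. -/
def IsAccurate (Γ K : Set Space) (p : ℕ) (h Cx Cm : ℝ) (y : Fin N → Space) : Prop :=
  (∀ i, y i ∈ K ∧ ‖P.pos i - y i‖ ≤ Cx * h ^ (p + 1) ∧ ‖P.m i‖ = 1 ∧
    ∃ ν, IsUnitNormal Γ (y i) ν ∧ ‖P.m i - ν‖ ≤ Cm * h) ∧
  ∀ j k, 0 < ⟪P.m (P.tri j), P.m (P.tri k)⟫

/-- The Hermite normals at the vertices in `S` are accurate to `Cn * h ^ p`. -/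
def NormalsAccurateOn (Γ : Set Space) (p : ℕ) (h Cn : ℝ) (y : Fin N → Space)
    (S : Finset (Fin N)) : Prop :=
  ∀ i ∈ S, ∃ ν, IsUnitNormal Γ (y i) ν ∧ ‖P.n i - ν‖ ≤ Cn * h ^ p

end MeshPatch

/-! ### CMF and H-CMF reconstructions of a point -/

/-- The data of a local fitting of degree `p`: the intermediate point that is projected, the
tangential axes of the frame, the stencil, the weights, and the rescaled coefficients. -/
structure LocalFit (p N : ℕ) where
  base : Space
  s : Space
  t : Space
  stencil : Finset (Fin N)
  weight : Fin N → ℝ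
  coeff : MonoIdx p → ℝ

namespace LocalFit

variable {p N : ℕ} (A : LocalFit p N) (P : MeshPatch N) (ξ : Plane) (h : ℝ)

/-- The moving frame at the intermediate point with natural coordinates `ξ`. -/
def frame : LocalFrame := ⟨A.base, A.s, A.t, P.avgNormal ξ⟩

/-- The positions of the stencil. -/
def stencilPos : A.stencil → Space := fun i => P.pos i

/-- The Hermite normals of the stencil. -/
def stencilNormal : A.stencil → Space := fun i => P.n i

/-- The weights of the stencil. -/
def stencilWeight : A.stencil → ℝ := fun i => A.weight i

/-- All points of the stencil and all corners of the triangle are within `R * h` of the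
intermediate point. -/
def IsLocal (R : ℝ) : Prop :=
  (∀ i ∈ A.stencil, ‖P.pos i - A.base‖ ≤ R * h) ∧ ∀ j, ‖P.pos (P.tri j) - A.base‖ ≤ R * h

/-- The coefficients are those of the degree-`p` CMF reconstruction. -/
def IsCMF : Prop :=
  (A.frame P ξ).IsOrthonormal ∧
  IsWeightedLeastSquares A.stencilWeight ((A.frame P ξ).pointMatrix h p (A.stencilPos P))
    ((A.frame P ξ).pointRhs (A.stencilPos P)) A.coeff

/-- The coefficients are those of the degree-`p` H-CMF reconstruction. -/
def IsHCMF : Prop :=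
  (A.frame P ξ).IsOrthonormal ∧
  IsWeightedLeastSquares (tripleWeight A.stencilWeight)
    ((A.frame P ξ).hermiteMatrix h p (A.stencilPos P))
    ((A.frame P ξ).hermiteRhs h (A.stencilPos P) (A.stencilNormal P)) A.coeff

/-- The weighted rescaled matrix of the point-based fitting. -/
def cmfSystem : Matrix A.stencil (MonoIdx p) ℝ :=
  Matrix.diagonal A.stencilWeight * (A.frame P ξ).pointMatrix h p (A.stencilPos P)

/-- The weighted rescaled matrix of the Hermite-style fitting. -/
def hcmfSystem : Matrix (A.stencil ⊕ (A.stencil ⊕ A.stencil)) (MonoIdx p) ℝ :=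
  Matrix.diagonal (tripleWeight A.stencilWeight) *
    (A.frame P ξ).hermiteMatrix h p (A.stencilPos P)

/-- The projection of the intermediate point: the point of the fitted graph over the origin of
the local frame. -/
def projection : Space := A.base + A.coeff (MonoIdx.zero p) • P.avgNormal ξ

end LocalFit

/-! ### Parametric surface elements -/

/-- The number of nodes of a degree-`p` triangular element. -/
abbrev numNodes (p : ℕ) : ℕ := (p + 1) * (p + 2) / 2

/-- The value of a polynomial at natural coordinates. -/
def shapeEval (q : MvPolynomial (Fin 2) ℝ) (ξ : Plane) : ℝ := MvPolynomial.eval (fun k => ξ k) q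

/-- `B` is the Lagrange basis of degree-`p` interpolation at the nodes `ξ`. -/
def IsLagrangeBasis (p : ℕ) (ξ : Fin (numNodes p) → Plane)
    (B : Fin (numNodes p) → MvPolynomial (Fin 2) ℝ) : Prop :=
  (∀ i, (B i).totalDegree ≤ p) ∧ ∀ i j, shapeEval (B i) (ξ j) = if i = j then 1 else 0

/-- The Lebesgue function of the interpolation is at most `Λ` on the reference triangle. -/
def IsStable (p : ℕ) (B : Fin (numNodes p) → MvPolynomial (Fin 2) ℝ) (Λ : ℝ) : Prop :=
  ∀ ξ ∈ refTriangle, ∑ i, |shapeEval (B i) ξ| ≤ Λ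

/-- The parametric element with nodes `x`, as a function of the natural coordinates `ζ = h • ξ`
that are measured at the length scale `h`; they range over the reference triangle with legs `h`. -/
def elementMap {p : ℕ} (h : ℝ) (B : Fin (numNodes p) → MvPolynomial (Fin 2) ℝ)
    (x : Fin (numNodes p) → Space) (ζ : Plane) : Space :=
  ∑ i, shapeEval (B i) (h⁻¹ • ζ) • x i

/-- The derivatives of `f` of orders `1, …, q` are bounded by `M` on `h • refTriangle`. -/
def IsSmoothToDegree (q : ℕ) (h M : ℝ) (f : Plane → Space) : Prop :=
  ∀ k : ℕ, 1 ≤ k → k ≤ q → ∀ ξ ∈ refTriangle, ‖iteratedFDeriv ℝ k f (h • ξ)‖ ≤ M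

/-- `x` is a node with reference coordinates `ξ` that is either a corner of the input triangle, or
obtained by degree-`p` CMF, or obtained by degree-`p` H-CMF, with stencil radius at most `R * h`,
well-conditioned rescaled systems and, for H-CMF, normals accurate to `Cn * h ^ p`. -/
def IsReconstructedNode (Γ : Set Space) (s : ℝ≥0∞) [Fact (1 ≤ s)] (p : ℕ) (h R Cn κ : ℝ) {N : ℕ}
    (P : MeshPatch N) (y : Fin N → Space) (ξ : Plane) (x : Space) : Prop :=
  (∃ j, x = P.pos (P.tri j)) ∨
  (∃ A : LocalFit p N, A.IsLocal P h R ∧ A.IsCMF P ξ h ∧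
    WellConditioned s κ (A.cmfSystem P ξ h) ∧ x = A.projection P ξ) ∨
  (∃ A : LocalFit p N, A.IsLocal P h R ∧ A.IsHCMF P ξ h ∧
    WellConditioned s κ (A.hcmfSystem P ξ h) ∧ P.NormalsAccurateOn Γ p h Cn y A.stencil ∧
    x = A.projection P ξ)

end

/-! Near a point of `K` the surface is `F = 0` with nonvanishing gradient. The implicit function
theorem yields `ψ (a, m, ε)`, the height over `a` in the direction `m` of the level set `F = ε`, of
class `C^(p+1)` in all arguments jointly. Hence one derivative bound serves all moving frames whose
normal is close to a fixed direction, and the Lipschitz dependence on `ε` turns a small value of `F`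
into a small distance from `Γ`.

Nodes. The degree-`p` Taylor polynomial of `ψ` at the projected point, restricted to the tangential
plane of the frame, solves the fitting equations up to `O(h^(p+1))`
(`IsGraphChart.exists_competitor`); in the Hermite rows the factor `h` makes up for the order lost
by differentiation. By the normal equations, the fitted coefficients differ from the Taylor
coefficients by the pseudo-inverse `A⁺` of the weighted matrix `A` applied to the weighted residual.
Each row of the unweighted matrix has an entry of modulus at least 1, so this residual is
`O(h^(p+1)) ‖A‖`, and only the condition number survives, not the weights or the stencil size
(`IsWeightedLeastSquares.abs_sub_le`). So `c₀₀` is `O(h^(p+1))`-close to a height at which the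
surface is met.

Elements. `F ∘ x` has bounded derivatives of order `p + 1` and nodal values `O(h^(p+1))`.
Interpolation reproduces its Taylor polynomial, so stability spreads the nodal bound over the
element (`abs_le_of_nodal_bound`), and `ψ` converts it into a distance
(`exists_element_bound_near`).

Normals are determined only up to sign; consistent orientation places the averaged normal near one
of two opposite directions, each with its own chart. Compactness of `K` makes the local constants
uniform. -/

/-! ### Taylor expansion with remainder in normed spaces -/

section Taylor

variable {E : Type} [NormedAddCommGroup E] [NormedSpace ℝ E]

/-- The Taylor polynomial of degree `n` of `f` at `a`, evaluated at the increment `x`. -/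
noncomputable def taylorSum {F : Type} [NormedAddCommGroup F] [NormedSpace ℝ F] (n : ℕ) (f : E → F) (a x : E) :
    F :=
  ∑ k ∈ Finset.range (n + 1), ((Nat.factorial k : ℝ)⁻¹) • iteratedFDeriv ℝ k f a (fun _ => x)

theorem iteratedFDeriv_succ_diag {F : Type} [NormedAddCommGroup F] [NormedSpace ℝ F] (k : ℕ)
    (f : E → F) (a x : E) :
    iteratedFDeriv ℝ (k + 1) f a (fun _ => x) =
      iteratedFDeriv ℝ k (fderiv ℝ f) a (fun _ => x) x := by
  rw [iteratedFDeriv_succ_apply_right]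
  rfl

theorem iteratedFDeriv_clm_comp_diag {F G : Type} [NormedAddCommGroup F] [NormedSpace ℝ F]
    [NormedAddCommGroup G] [NormedSpace ℝ G] (L : F →L[ℝ] G) {k : ℕ} {f : E → F} {a : E}
    (hf : ContDiffAt ℝ k f a) (x : E) :
    iteratedFDeriv ℝ k (fun y => L (f y)) a (fun _ => x) =
      L (iteratedFDeriv ℝ k f a (fun _ => x)) := by
  have := L.iteratedFDeriv_comp_left hf (le_refl (k : WithTop ℕ∞))
  change iteratedFDeriv ℝ k (L ∘ f) a _ = _
  rw [this]
  rfl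

/-- The second derivative is symmetric on a whole neighbourhood, because finite-order smoothness at
`a` persists nearby. Flipping its two arguments is continuous linear and so commutes with further
differentiation. -/
theorem iteratedFDeriv_fderiv_fderiv_swap {k : ℕ} {F : Type} [NormedAddCommGroup F]
    [NormedSpace ℝ F] {f : E → F} {a : E} (hf : ContDiffAt ℝ (k + 2 : ℕ) f a) (x v w : E) :
    iteratedFDeriv ℝ k (fderiv ℝ (fderiv ℝ f)) a (fun _ => x) v w =
      iteratedFDeriv ℝ k (fderiv ℝ (fderiv ℝ f)) a (fun _ => x) w v := by
  have h2 : ContDiffAt ℝ k (fderiv ℝ (fderiv ℝ f)) a := by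
    have h1 : ContDiffAt ℝ (k + 1 : ℕ) (fderiv ℝ f) a :=
      hf.fderiv_right (by norm_cast)
    exact h1.fderiv_right (by norm_cast)
  let fl : (E →L[ℝ] E →L[ℝ] F) →L[ℝ] (E →L[ℝ] E →L[ℝ] F) :=
    (ContinuousLinearMap.flipₗᵢ ℝ E E F).toContinuousLinearEquiv.toContinuousLinearMap
  have hsymm : (fun y => fl (fderiv ℝ (fderiv ℝ f) y)) =ᶠ[nhds a] fderiv ℝ (fderiv ℝ f) := by
    filter_upwards [hf.eventually (WithTop.coe_injective.ne (ENat.natCast_ne_top (k + 2)))] with y hy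
    ext p q
    have hs : IsSymmSndFDerivAt ℝ f y := hy.isSymmSndFDerivAt (by simp)
    exact hs.eq q p
  have := iteratedFDeriv_clm_comp_diag (G := E →L[ℝ] E →L[ℝ] F) fl h2 x
  rw [(hsymm.iteratedFDeriv ℝ k).eq_of_nhds] at this
  conv_lhs => rw [this]
  rfl

theorem hasFDerivAt_iteratedFDeriv_diag (k : ℕ) : ∀ {F : Type} [NormedAddCommGroup F]
    [NormedSpace ℝ F] {f : E → F} {a : E}, ContDiffAt ℝ (k + 1 : ℕ) f a → ∀ x : E,
    HasFDerivAt (fun x => iteratedFDeriv ℝ (k + 1) f a (fun _ => x))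
      (((k + 1 : ℕ) : ℝ) • iteratedFDeriv ℝ k (fderiv ℝ f) a (fun _ => x)) x := by
  induction k with
  | zero =>
    intro F _ _ f a hf x
    simp only [iteratedFDeriv_succ_diag, iteratedFDeriv_zero_apply]
    simpa using (fderiv ℝ f a).hasFDerivAt (x := x)
  | succ k ih =>
    intro F _ _ f a hf x
    have h1 : ContDiffAt ℝ (k + 1 : ℕ) (fderiv ℝ f) a := hf.fderiv_right (by norm_cast)
    have h := (ih h1 x).clm_apply (hasFDerivAt_id x)
    have e : (fun x => iteratedFDeriv ℝ (k + 1 + 1) f a (fun _ => x)) =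
        fun x => iteratedFDeriv ℝ (k + 1) (fderiv ℝ f) a (fun _ => x) (id x) := by
      funext x; exact iteratedFDeriv_succ_diag (k + 1) f a x
    rw [e]
    refine h.congr_fderiv ?_
    ext v
    simp [iteratedFDeriv_succ_diag k (fderiv ℝ f)]
    -- The product rule leaves `k + 1` terms with `v` in an inner slot and one with `v` in the last
    -- slot; the swap identifies them, giving the factor `k + 2`.
    rw [iteratedFDeriv_fderiv_fderiv_swap hf x v x, add_smul (_ + _), one_smul, add_comm]

theorem taylorSum_zero_right {F : Type} [NormedAddCommGroup F] [NormedSpace ℝ F] (n : ℕ)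
    (f : E → F) (a : E) : taylorSum n f a 0 = f a := by
  unfold taylorSum
  rw [Finset.sum_range_succ']
  have : ∀ k ∈ Finset.range n, ((Nat.factorial (k + 1) : ℝ)⁻¹) •
      iteratedFDeriv ℝ (k + 1) f a (fun _ => (0 : E)) = 0 := by
    intro k _
    rw [ContinuousMultilinearMap.map_coord_zero _ (0 : Fin (k + 1)) rfl, smul_zero]
  rw [Finset.sum_eq_zero this]
  simp

/-- Differentiation commutes with Taylor expansion at the cost of one degree. This drives the
induction for the remainder and also handles the Hermite equations. -/
theorem hasFDerivAt_taylorSum {F : Type} [NormedAddCommGroup F] [NormedSpace ℝ F] {n : ℕ}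
    {f : E → F} {a : E} (hf : ContDiffAt ℝ (n + 1 : ℕ) f a) (x : E) :
    HasFDerivAt (taylorSum (n + 1) f a) (taylorSum n (fderiv ℝ f) a x) x := by
  have e : taylorSum (n + 1) f a = fun x => (∑ k ∈ Finset.range (n + 1), ((Nat.factorial (k + 1) : ℝ)⁻¹) •
      iteratedFDeriv ℝ (k + 1) f a (fun _ => x)) + f a := by
    funext x
    unfold taylorSum
    rw [Finset.sum_range_succ']
    simp
  rw [e]
  apply HasFDerivAt.add_const
  unfold taylorSum
  apply HasFDerivAt.fun_sum
  intro k hk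
  have hk' : k + 1 ≤ n + 1 := by simpa using Finset.mem_range.1 hk
  have h := (hasFDerivAt_iteratedFDeriv_diag k (hf.of_le (by exact_mod_cast hk')) x).const_smul
    ((Nat.factorial (k + 1) : ℝ)⁻¹)
  refine h.congr_fderiv ?_
  rw [smul_smul]
  congr 1
  rw [Nat.factorial_succ]
  push_cast
  field_simp

theorem norm_sub_taylorSum_le (n : ℕ) : ∀ {F : Type} [NormedAddCommGroup F] [NormedSpace ℝ F]
    {f : E → F} {a x : E} {M : ℝ},
    (∀ y ∈ segment ℝ 0 x, ContDiffAt ℝ (n + 1 : ℕ) f (a + y)) →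
    (∀ y ∈ segment ℝ 0 x, ‖iteratedFDeriv ℝ (n + 1) f (a + y)‖ ≤ M) →
    ‖f (a + x) - taylorSum n f a x‖ ≤ M * ‖x‖ ^ (n + 1) := by
  -- The mean value inequality on the segment gains one power of `‖x‖` per induction step; the
  -- factorial in the remainder is not needed.
  have key : ∀ {F : Type} [NormedAddCommGroup F] [NormedSpace ℝ F] {f : E → F} {a x : E} {B : ℝ}
      {g : E → F} {g' : E → E →L[ℝ] F}, (∀ y ∈ segment ℝ 0 x, DifferentiableAt ℝ f (a + y)) →
      (∀ y, HasFDerivAt g (g' y) y) → g 0 = f a →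
      (∀ y ∈ segment ℝ 0 x, ‖fderiv ℝ f (a + y) - g' y‖ ≤ B) →
      ‖f (a + x) - g x‖ ≤ B * ‖x‖ := by
    intro F _ _ f a x B g g' hf hg h0 hB
    have hd : ∀ y ∈ segment ℝ (0 : E) x, HasFDerivWithinAt (fun y => f (a + y) - g y)
        (fderiv ℝ f (a + y) - g' y) (segment ℝ 0 x) y := by
      intro y hy
      have h1 : HasFDerivAt (fun y => f (a + y)) (fderiv ℝ f (a + y)) y := by
        rw [hasFDerivAt_comp_add_left]
        exact (hf y hy).hasFDerivAt
      exact (h1.sub (hg y)).hasFDerivWithinAt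
    have := (convex_segment (0 : E) x).norm_image_sub_le_of_norm_hasFDerivWithin_le hd hB
      (left_mem_segment ℝ 0 x) (right_mem_segment ℝ 0 x)
    simpa [h0] using this
  induction n with
  | zero =>
    intro F _ _ f a x M hf hM
    have := key (f := f) (a := a) (x := x) (B := M) (g := fun _ => f a) (g' := fun _ => 0)
      (fun y hy => (hf y hy).differentiableAt (by simp)) (fun y => hasFDerivAt_const _ _) rfl
      (fun y hy => by
        have := hM y hy
        rw [zero_add, norm_iteratedFDeriv_one] at this
        simpa using this)
    simpa [taylorSum] using this
  | succ n ih =>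
    intro F _ _ f a x M hf hM
    have hM0 : 0 ≤ M := (norm_nonneg _).trans (hM x (right_mem_segment ℝ 0 x))
    rw [pow_succ, ← mul_assoc]
    have hfa : ContDiffAt ℝ (n + 1 : ℕ) f a := by
      simpa using (hf 0 (left_mem_segment ℝ 0 x)).of_le (by norm_cast; omega)
    refine key (g := taylorSum (n + 1) f a) (g' := taylorSum n (fderiv ℝ f) a)
      (fun y hy => (hf y hy).differentiableAt (by simp)) (hasFDerivAt_taylorSum hfa)
      (taylorSum_zero_right _ _ _) ?_
    intro y hy
    have hsub : segment ℝ 0 y ⊆ segment ℝ (0 : E) x :=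
      (convex_segment (0 : E) x).segment_subset (left_mem_segment ℝ 0 x) hy
    have h := ih (f := fderiv ℝ f) (a := a) (x := y) (M := M)
      (fun z hz => (hf z (hsub hz)).fderiv_right (by norm_cast))
      (fun z hz => by rw [norm_iteratedFDeriv_fderiv]; exact hM z (hsub hz))
    refine h.trans ?_
    have hyx : ‖y‖ ≤ ‖x‖ := by
      obtain ⟨t, ht, rfl⟩ := (segment_eq_image ℝ (0 : E) x ▸ hy)
      simp only [smul_zero, zero_add, norm_smul, Real.norm_eq_abs, abs_of_nonneg ht.1]
      exact mul_le_of_le_one_left (norm_nonneg _) ht.2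
    gcongr

end Taylor

/-! ### Bivariate polynomials and Lagrange interpolation -/

section BivariatePolynomials

/-- The bivariate polynomial functions of total degree at most `p`. -/
def bivariatePoly (p : ℕ) : Submodule ℝ (ℝ → ℝ → ℝ) :=
  Submodule.span ℝ (Set.range fun (a : MonoIdx p) (μ ν : ℝ) => μ ^ a.1.1.val * ν ^ a.1.2.val)

theorem mem_bivariatePoly_iff {p : ℕ} {g : ℝ → ℝ → ℝ} : g ∈ bivariatePoly p ↔
    ∃ d : MonoIdx p → ℝ, ∀ μ ν, g μ ν = ∑ a, d a * (μ ^ a.1.1.val * ν ^ a.1.2.val) := by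
  unfold bivariatePoly
  rw [Submodule.mem_span_range_iff_exists_fun]
  constructor
  · rintro ⟨d, rfl⟩
    exact ⟨d, fun μ ν => by simp⟩
  · rintro ⟨d, hd⟩
    exact ⟨d, by funext μ ν; simp [hd]⟩

theorem monomial_mem_bivariatePoly {p j k : ℕ} (h : j + k ≤ p) :
    (fun μ ν : ℝ => μ ^ j * ν ^ k) ∈ bivariatePoly p :=
  Submodule.subset_span ⟨⟨(⟨j, by omega⟩, ⟨k, by omega⟩), h⟩, rfl⟩

/-- Multilinear expansion over the set `r` of slots that receive `S` yields the monomials `μ ^ |r| *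
ν ^ (k - |r|)`. -/
theorem diag_mem_bivariatePoly {E : Type} [NormedAddCommGroup E] [NormedSpace ℝ E] {k p : ℕ}
    (hk : k ≤ p) (A : ContinuousMultilinearMap ℝ (fun _ : Fin k => E) ℝ) (S T : E) :
    (fun μ ν : ℝ => A (fun _ => μ • S + ν • T)) ∈ bivariatePoly p := by
  classical
  have e : (fun μ ν : ℝ => A (fun _ => μ • S + ν • T)) =
      ∑ r : Finset (Fin k), A (r.piecewise (fun _ => S) (fun _ => T)) •
        fun μ ν : ℝ => μ ^ r.card * ν ^ (k - r.card) := by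
    funext μ ν
    have h := A.toMultilinearMap.map_add_univ (fun _ => μ • S) (fun _ => ν • T)
    simp only [Finset.sum_apply, Pi.smul_apply, smul_eq_mul]
    refine h.trans (Finset.sum_congr rfl fun r _ => ?_)
    have h1 : r.piecewise (fun _ => μ • S) (fun _ => ν • T) =
        fun i => (if i ∈ r then μ else ν) • r.piecewise (fun _ => S) (fun _ => T) i := by
      funext i
      by_cases hi : i ∈ r <;> simp [hi]
    rw [h1, MultilinearMap.map_smul_univ, Finset.prod_ite, mul_comm]
    simp [Finset.filter_not, Finset.card_sdiff]
    ring
  rw [e]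
  refine Submodule.sum_mem _ fun r _ => Submodule.smul_mem _ _ (monomial_mem_bivariatePoly ?_)
  have : r.card ≤ k := by simpa using Finset.card_le_univ r
  omega

theorem taylorSum_mem_bivariatePoly {E : Type} [NormedAddCommGroup E] [NormedSpace ℝ E] (p : ℕ)
    (f : E → ℝ) (a S T : E) :
    (fun μ ν : ℝ => taylorSum p f a (μ • S + ν • T)) ∈ bivariatePoly p := by
  have e : (fun μ ν : ℝ => taylorSum p f a (μ • S + ν • T)) =
      ∑ k ∈ Finset.range (p + 1), ((Nat.factorial k : ℝ)⁻¹) •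
        fun μ ν : ℝ => iteratedFDeriv ℝ k f a (fun _ => μ • S + ν • T) := by
    funext μ ν
    simp [taylorSum]
  rw [e]
  exact Submodule.sum_mem _ fun k hk => Submodule.smul_mem _ _
    (diag_mem_bivariatePoly (by simpa [Nat.lt_succ_iff] using hk) _ _ _)

/-- In the plane spanned by `S` and `T`, the Taylor polynomial and its two directional derivatives
are given by one set of monomial coefficients. -/
theorem exists_taylorSum_coeff {E : Type} [NormedAddCommGroup E] [NormedSpace ℝ E] {n : ℕ}
    {f : E → ℝ} {a : E} (hf : ContDiffAt ℝ (n + 1 : ℕ) f a) (S T : E) :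
    ∃ d : MonoIdx (n + 1) → ℝ, d (MonoIdx.zero (n + 1)) = f a ∧
      (∀ μ ν : ℝ, taylorSum (n + 1) f a (μ • S + ν • T) =
        ∑ a, (μ ^ a.1.1.val * ν ^ a.1.2.val) * d a) ∧
      (∀ μ ν : ℝ, taylorSum n (fderiv ℝ f) a (μ • S + ν • T) S =
        ∑ a, ((a.1.1.val : ℝ) * μ ^ (a.1.1.val - 1) * ν ^ a.1.2.val) * d a) ∧
      ∀ μ ν : ℝ, taylorSum n (fderiv ℝ f) a (μ • S + ν • T) T =
        ∑ a, ((a.1.2.val : ℝ) * μ ^ a.1.1.val * ν ^ (a.1.2.val - 1)) * d a := by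
  obtain ⟨d, hd⟩ := mem_bivariatePoly_iff.1 (taylorSum_mem_bivariatePoly (n + 1) f a S T)
  refine ⟨d, ?_, fun μ ν => (hd μ ν).trans (Finset.sum_congr rfl fun _ _ => mul_comm _ _), ?_, ?_⟩
  · have h := hd 0 0
    rw [zero_smul, zero_smul, add_zero, taylorSum_zero_right,
      Finset.sum_eq_single (MonoIdx.zero (n + 1))] at h
    · simpa [MonoIdx.zero] using h.symm
    · rintro ⟨⟨j, k⟩, hb⟩ - hne
      have : j.val ≠ 0 ∨ k.val ≠ 0 := by
        by_contra! hc
        apply hne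
        apply Subtype.ext
        exact Prod.ext (Fin.ext hc.1) (Fin.ext hc.2)
      rcases this with h | h <;> simp [h]
    · simp
  -- The value identity is differentiated in `μ` in two ways; uniqueness of the derivative gives the
  -- coefficients of the slope without a second expansion.
  · intro μ ν
    have h1 : HasDerivAt (fun μ : ℝ => taylorSum (n + 1) f a (μ • S + ν • T))
        (taylorSum n (fderiv ℝ f) a (μ • S + ν • T) S) μ := by
      refine (hasFDerivAt_taylorSum hf _).comp_hasDerivAt μ ?_
      simpa using ((hasDerivAt_id μ).smul_const S).add_const (ν • T)
    have h2 : HasDerivAt (fun μ : ℝ => ∑ a, d a * (μ ^ a.1.1.val * ν ^ a.1.2.val))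
        (∑ a : MonoIdx (n + 1),
          ((a.1.1.val : ℝ) * μ ^ (a.1.1.val - 1) * ν ^ a.1.2.val) * d a) μ := by
      apply HasDerivAt.fun_sum
      intro b _
      refine (((hasDerivAt_pow b.1.1.val μ).mul_const (ν ^ b.1.2.val)).const_mul (d b)).congr_deriv ?_
      ring
    simp only [hd] at h1
    exact h1.unique h2
  · intro μ ν
    have h1 : HasDerivAt (fun ν : ℝ => taylorSum (n + 1) f a (μ • S + ν • T))
        (taylorSum n (fderiv ℝ f) a (μ • S + ν • T) T) ν := by
      refine (hasFDerivAt_taylorSum hf _).comp_hasDerivAt ν ?_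
      simpa using ((hasDerivAt_id ν).smul_const T).const_add (μ • S)
    have h2 : HasDerivAt (fun ν : ℝ => ∑ a, d a * (μ ^ a.1.1.val * ν ^ a.1.2.val))
        (∑ a : MonoIdx (n + 1),
          ((a.1.2.val : ℝ) * μ ^ a.1.1.val * ν ^ (a.1.2.val - 1)) * d a) ν := by
      apply HasDerivAt.fun_sum
      intro b _
      refine (((hasDerivAt_pow b.1.2.val ν).const_mul (μ ^ b.1.1.val)).const_mul (d b)).congr_deriv ?_
      ring
    simp only [hd] at h1
    exact h1.unique h2

/-- Supplies the dimension bound by which as many independent polynomials as there are nodes must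
span. -/
theorem card_monoIdx_le (p : ℕ) : Fintype.card (MonoIdx p) ≤ numNodes p := by
  let φ : MonoIdx p → Σ j : Fin (p + 1), Fin (p + 1 - j.val) := fun a =>
    ⟨a.1.1, ⟨a.1.2.val, by have := a.2; omega⟩⟩
  have hφ : Function.Injective φ := by
    rintro ⟨⟨j, k⟩, hb⟩ ⟨⟨j', k'⟩, hb'⟩ h
    simp only [φ, Sigma.mk.injEq] at h
    obtain ⟨rfl, h⟩ := h
    simp only [heq_eq_eq, Fin.mk.injEq] at h
    have : k = k' := Fin.ext h
    subst this
    rfl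
  refine (Fintype.card_le_of_injective φ hφ).trans (le_of_eq ?_)
  simp only [Fintype.card_sigma, Fintype.card_fin]
  rw [Fin.sum_univ_eq_sum_range (fun j => p + 1 - j) (p + 1)]
  refine (Nat.div_eq_of_eq_mul_left two_pos ?_).symm
  clear hφ φ
  induction p with
  | zero => rfl
  | succ p ih =>
    rw [Finset.sum_range_succ']
    simp only [Nat.add_sub_add_right, Nat.sub_zero]
    linarith

theorem shapeEval_mem_bivariatePoly {p : ℕ} {q : MvPolynomial (Fin 2) ℝ} (hq : q.totalDegree ≤ p) :
    (fun μ ν : ℝ => shapeEval q !₂[μ, ν]) ∈ bivariatePoly p := by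
  have e : (fun μ ν : ℝ => shapeEval q !₂[μ, ν]) =
      ∑ d ∈ q.support, q.coeff d • fun μ ν : ℝ => μ ^ d 0 * ν ^ d 1 := by
    funext μ ν
    simp [shapeEval, MvPolynomial.eval_eq', Fin.prod_univ_two]
  rw [e]
  refine Submodule.sum_mem _ fun d hd => Submodule.smul_mem _ _ (monomial_mem_bivariatePoly ?_)
  have h := MvPolynomial.le_totalDegree hd
  rw [Finsupp.sum_fintype _ _ (fun _ => rfl), Fin.sum_univ_two] at h
  omega

/-- Lagrange interpolation reproduces polynomials. -/
theorem IsLagrangeBasis.eq_sum {p : ℕ} {ξ : Fin (numNodes p) → Plane}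
    {B : Fin (numNodes p) → MvPolynomial (Fin 2) ℝ} (hB : IsLagrangeBasis p ξ B)
    {g : ℝ → ℝ → ℝ} (hg : g ∈ bivariatePoly p) (η : Plane) :
    g (η 0) (η 1) = ∑ i, shapeEval (B i) η * g (ξ i 0) (ξ i 1) := by
  let N : Fin (numNodes p) → ℝ → ℝ → ℝ := fun i μ ν => shapeEval (B i) !₂[μ, ν]
  have hval : ∀ i (η : Plane), N i (η 0) (η 1) = shapeEval (B i) η := by
    intro i η
    have : !₂[η 0, η 1] = η := by ext k; fin_cases k <;> rfl
    simp only [N, this]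
  have hnode : ∀ i j, N i (ξ j 0) (ξ j 1) = if i = j then 1 else 0 := fun i j =>
    (hval i (ξ j)).trans (hB.2 i j)
  have hli : LinearIndependent ℝ N := by
    rw [Fintype.linearIndependent_iff]
    intro c hc j
    have := congrFun (congrFun hc (ξ j 0)) (ξ j 1)
    simpa [hnode] using this
  have hle : Submodule.span ℝ (Set.range N) ≤ bivariatePoly p := by
    rw [Submodule.span_le]
    rintro _ ⟨i, rfl⟩
    exact shapeEval_mem_bivariatePoly (hB.1 i)
  have hfin : FiniteDimensional ℝ (bivariatePoly p) :=
    FiniteDimensional.span_of_finite ℝ (Set.finite_range _)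
  -- The `N i` are independent by duality with the nodes, and the space has dimension at most their
  -- number.
  have heq : Submodule.span ℝ (Set.range N) = bivariatePoly p := by
    apply Submodule.eq_of_le_of_finrank_le hle
    rw [finrank_span_eq_card hli, Fintype.card_fin]
    exact (finrank_range_le_card _).trans (card_monoIdx_le p)
  rw [← heq, Submodule.mem_span_range_iff_exists_fun] at hg
  obtain ⟨c, rfl⟩ := hg
  simp [hnode, hval, mul_comm]

end BivariatePolynomials

/-! ### Weighted least squares and the condition number -/

section LeastSquares

theorem PiLp.norm_le_of_abs_le {ι : Type} [Fintype ι] {s : ℝ≥0∞} [Fact (1 ≤ s)]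
    {x y : PiLp s (fun _ : ι => ℝ)} (h : ∀ i, |x i| ≤ |y i|) : ‖x‖ ≤ ‖y‖ := by
  rcases eq_or_ne s ∞ with rfl | hs
  · rw [PiLp.norm_eq_ciSup, PiLp.norm_eq_ciSup]
    exact ciSup_mono (Set.finite_range _).bddAbove h
  · have hpos : 0 < s.toReal := ENNReal.toReal_pos (zero_lt_one.trans_le Fact.out).ne' hs
    rw [PiLp.norm_eq_sum hpos, PiLp.norm_eq_sum hpos]
    have := hpos.le
    gcongr with i
    exact h i

variable {m n : Type} [Fintype m] [Fintype n] [DecidableEq n]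

theorem norm_toLp_mulVec_le (s : ℝ≥0∞) [Fact (1 ≤ s)] (A : Matrix m n ℝ) (x : n → ℝ) :
    ‖WithLp.toLp s (A.mulVec x)‖ ≤ lpOpNorm s A * ‖WithLp.toLp s x‖ :=
  (LinearMap.toContinuousLinearMap (Matrix.toLpLin s s A)).le_opNorm (WithLp.toLp s x)

theorem lpOpNorm_nonneg (s : ℝ≥0∞) [Fact (1 ≤ s)] (A : Matrix m n ℝ) : 0 ≤ lpOpNorm s A :=
  norm_nonneg _

theorem norm_toLp_col_le (s : ℝ≥0∞) [Fact (1 ≤ s)] (A : Matrix m n ℝ) (a : n) :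
    ‖WithLp.toLp s (A.col a)‖ ≤ lpOpNorm s A := by
  have h := norm_toLp_mulVec_le s A (Pi.single a 1)
  rw [Matrix.mulVec_single_one] at h
  refine h.trans (le_of_eq ?_)
  have h1 : ‖WithLp.toLp s (Pi.single a (1 : ℝ) : n → ℝ)‖ = 1 :=
    (PiLp.norm_single s (fun _ : n => ℝ) a (1 : ℝ)).trans norm_one
  rw [h1, mul_one]

/-- A vector that is dominated in each entry by one of the columns of `A`. -/
theorem norm_toLp_le_of_dominated (s : ℝ≥0∞) [Fact (1 ≤ s)] {A : Matrix m n ℝ} {x : m → ℝ} {ρ : ℝ}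
    (hρ : 0 ≤ ρ) (h : ∀ r, ∃ a, |x r| ≤ ρ * |A r a|) :
    ‖WithLp.toLp s x‖ ≤ Fintype.card n * (ρ * lpOpNorm s A) := by
  have h1 : ‖WithLp.toLp s x‖ ≤ ‖WithLp.toLp s (fun r => ∑ a, ρ * |A r a|)‖ := by
    apply PiLp.norm_le_of_abs_le
    intro r
    obtain ⟨a, ha⟩ := h r
    refine (ha.trans ?_).trans (le_abs_self _)
    exact Finset.single_le_sum (f := fun a => ρ * |A r a|) (fun b _ => by positivity)
      (Finset.mem_univ a)
  have h2 : WithLp.toLp s (fun r => ∑ a, ρ * |A r a|) =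
      ∑ a, ρ • WithLp.toLp s (fun r => |A r a|) := by
    ext r
    simp
  rw [h2] at h1
  refine h1.trans ((norm_sum_le _ _).trans ?_)
  rw [← nsmul_eq_mul, ← Finset.card_univ]
  refine Finset.sum_le_card_nsmul _ _ _ fun a _ => ?_
  rw [norm_smul, Real.norm_of_nonneg hρ]
  refine mul_le_mul_of_nonneg_left ?_ hρ
  refine le_trans (PiLp.norm_le_of_abs_le fun r => ?_) (norm_toLp_col_le s A a)
  simp

theorem isUnit_transpose_mul_self {A : Matrix m n ℝ} (hA : LinearIndependent ℝ A.col) :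
    IsUnit (A.transpose * A) := by
  have h := Matrix.PosDef.conjTranspose_mul_self A
    (Matrix.mulVec_injective_iff.2 hA)
  rw [Matrix.conjTranspose_eq_transpose_of_trivial] at h
  exact h.isUnit

/-- Along each line `c + t • e` the excess of the objective is a nonnegative quadratic in `t`
without constant term. Its discriminant is the square of its linear coefficient, which must
therefore vanish. -/
theorem IsWeightedLeastSquares.normal_eq [DecidableEq m] {ω : m → ℝ} {V : Matrix m n ℝ} {g : m → ℝ}
    {c : n → ℝ} (h : IsWeightedLeastSquares ω V g c) :
    (Matrix.diagonal ω * V).transpose.mulVec (fun r => ω r * (V.mulVec c r - g r)) = 0 := by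
  set A := Matrix.diagonal ω * V
  have hA : ∀ e r, ω r * V.mulVec e r = A.mulVec e r := by
    intro e r
    simp only [A, ← Matrix.mulVec_mulVec, Matrix.mulVec_diagonal]
  set q : m → ℝ := fun r => ω r * (V.mulVec c r - g r) with hq
  have key : ∀ e : n → ℝ, dotProduct q (A.mulVec e) = 0 := by
    intro e
    have hquad : ∀ t : ℝ, 0 ≤ (∑ r, A.mulVec e r ^ 2) * (t * t) +
        (2 * dotProduct q (A.mulVec e)) * t + 0 := by
      intro t
      have h1 := h (c + t • e)
      have h2 : ∀ r, ω r * (V.mulVec (c + t • e) r - g r) = q r + t * A.mulVec e r := by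
        intro r
        rw [Matrix.mulVec_add, Matrix.mulVec_smul, ← hA]
        simp only [Pi.add_apply, Pi.smul_apply, smul_eq_mul, hq]
        ring
      simp only [h2] at h1
      have h3 : ∑ r, (q r + t * A.mulVec e r) ^ 2 = ∑ r, q r ^ 2 +
          (2 * dotProduct q (A.mulVec e)) * t + (∑ r, A.mulVec e r ^ 2) * (t * t) := by
        simp only [dotProduct, Finset.mul_sum, Finset.sum_mul, ← Finset.sum_add_distrib]
        exact Finset.sum_congr rfl fun r _ => by ring
      rw [h3] at h1
      have h4 : ∑ r, (ω r * (V.mulVec c r - g r)) ^ 2 = ∑ r, q r ^ 2 := rfl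
      linarith
    have := discrim_le_zero hquad
    rw [discrim] at this
    nlinarith [sq_nonneg (dotProduct q (A.mulVec e))]
  funext a
  have := key (Pi.single a 1)
  rw [Matrix.mulVec_single_one, dotProduct_comm] at this
  exact this

/-- The error of a well-conditioned weighted least squares fit is at most a multiple of the
largest residual of any competitor, independently of the number of equations and the weights. -/
theorem IsWeightedLeastSquares.abs_sub_le [DecidableEq m] {s : ℝ≥0∞} [Fact (1 ≤ s)] {κ ρ : ℝ}
    {ω : m → ℝ} {V : Matrix m n ℝ} {g : m → ℝ} {c d : n → ℝ}
    (h : IsWeightedLeastSquares ω V g c) (hV : WellConditioned s κ (Matrix.diagonal ω * V))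
    (hρ : 0 ≤ ρ) (hres : ∀ r, |V.mulVec d r - g r| ≤ ρ) (hcol : ∀ r, ∃ a, 1 ≤ |V r a|) (a : n) :
    |c a - d a| ≤ Fintype.card n * κ * ρ := by
  set A := Matrix.diagonal ω * V with hAdef
  have hA : ∀ e r, ω r * V.mulVec e r = A.mulVec e r := by
    intro e r
    simp only [A, ← Matrix.mulVec_mulVec, Matrix.mulVec_diagonal]
  set x : m → ℝ := fun r => ω r * (g r - V.mulVec d r) with hx
  have hunit := isUnit_transpose_mul_self hV.1
  have hsol : c - d = (pseudoInverse A).mulVec x := by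
    have h1 : (A.transpose * A).mulVec (c - d) = A.transpose.mulVec x := by
      have h2 := h.normal_eq
      rw [← Matrix.mulVec_mulVec, ← sub_eq_zero, ← Matrix.mulVec_sub, ← h2]
      congr 1
      funext r
      simp only [Matrix.mulVec_sub, Pi.sub_apply, ← hA, hx]
      ring
    rw [pseudoInverse, ← Matrix.mulVec_mulVec, ← h1, Matrix.mulVec_mulVec,
      Matrix.nonsing_inv_mul _ ((Matrix.isUnit_iff_isUnit_det _).1 hunit), Matrix.one_mulVec]
  have hxn : ‖WithLp.toLp s x‖ ≤ Fintype.card n * (ρ * lpOpNorm s A) := by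
    -- An entry `|V r b| ≥ 1` gives `|ω r| ≤ |A r b|`, so the weights enter only through `‖A‖`,
    -- which the condition number absorbs.
    refine norm_toLp_le_of_dominated s hρ fun r => ?_
    obtain ⟨b, hb⟩ := hcol r
    refine ⟨b, ?_⟩
    rw [hAdef, Matrix.diagonal_mul, hx, abs_mul, abs_mul, abs_sub_comm]
    calc |ω r| * |V.mulVec d r - g r| ≤ |ω r| * (ρ * |V r b|) := by
          gcongr
          exact (hres r).trans (le_mul_of_one_le_right hρ hb)
      _ = _ := by ring
  calc |c a - d a| = ‖(WithLp.toLp s (c - d)) a‖ := rfl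
    _ ≤ ‖WithLp.toLp s (c - d)‖ := PiLp.norm_apply_le _ a
    _ ≤ lpOpNorm s (pseudoInverse A) * (Fintype.card n * (ρ * lpOpNorm s A)) := by
        rw [hsol]
        exact (norm_toLp_mulVec_le s _ x).trans
          (mul_le_mul_of_nonneg_left hxn (lpOpNorm_nonneg s _))
    _ = Fintype.card n * condNumber s A * ρ := by
        rw [condNumber]
        ring
    _ ≤ _ := by
        gcongr
        exact hV.2

end LeastSquares

/-! ### Local equations of the surface and its normals -/

section LocalEquations

/-- `F = 0` is a regular equation of `Γ` in the ball of radius `ρ` around `y₀`, with bounds. -/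
structure IsLocalEquation (Γ : Set Space) (n : ℕ) (F : Space → ℝ) (y₀ : Space) (ρ L : ℝ) :
    Prop where
  radius_pos : 0 < ρ
  bound_pos : 0 < L
  contDiffAt : ∀ z ∈ Metric.ball y₀ ρ, ContDiffAt ℝ n F z
  mem_iff : ∀ z ∈ Metric.ball y₀ ρ, z ∈ Γ ↔ F z = 0
  lipschitz : ∀ z ∈ Metric.ball y₀ ρ, ∀ z' ∈ Metric.ball y₀ ρ, |F z - F z'| ≤ L * dist z z'
  fderiv_lipschitz : ∀ z ∈ Metric.ball y₀ ρ, ∀ z' ∈ Metric.ball y₀ ρ,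
    ‖fderiv ℝ F z - fderiv ℝ F z'‖ ≤ L * dist z z'
  one_le_fderiv : ∀ z ∈ Metric.ball y₀ ρ, 1 ≤ L * ‖fderiv ℝ F z‖
  iteratedFDeriv_le : ∀ k ≤ n, ∀ z ∈ Metric.ball y₀ ρ, ‖iteratedFDeriv ℝ k F z‖ ≤ L

theorem exists_lipschitz_ball_of_contDiffAt {E G : Type} [NormedAddCommGroup E]
    [NormedSpace ℝ E] [NormedAddCommGroup G] [NormedSpace ℝ G] {f : E → G} {x : E}
    (hf : ContDiffAt ℝ 1 f x) : ∃ L r : ℝ, 0 < r ∧ ∀ y ∈ Metric.ball x r,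
      ∀ y' ∈ Metric.ball x r, ‖f y - f y'‖ ≤ L * dist y y' := by
  obtain ⟨K, t, ht, hK⟩ := hf.exists_lipschitzOnWith
  obtain ⟨r, hr, hrt⟩ := Metric.mem_nhds_iff.1 ht
  exact ⟨K, r, hr, fun y hy y' hy' => by
    simpa [dist_eq_norm] using hK.dist_le_mul y (hrt hy) y' (hrt hy')⟩

theorem IsSurfaceOfClass.exists_isLocalEquation {p : ℕ} (hp : 1 ≤ p) {Γ : Set Space}
    (hΓ : IsSurfaceOfClass (p + 1) Γ) {y₀ : Space} (hy₀ : y₀ ∈ Γ) :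
    ∃ F ρ L, IsLocalEquation Γ (p + 1) F y₀ ρ L := by
  obtain ⟨U, F, hU, hyU, hF, hne, heq⟩ := hΓ y₀ hy₀
  have hFat : ∀ z ∈ U, ContDiffAt ℝ (p + 1 : ℕ) F z := fun z hz => hF.contDiffAt (hU.mem_nhds hz)
  have h0 := hFat y₀ hyU
  obtain ⟨r, hr, hrU⟩ := Metric.isOpen_iff.1 hU y₀ hyU
  obtain ⟨L₁, r₁, hr₁, hL₁⟩ := 
    exists_lipschitz_ball_of_contDiffAt (h0.of_le (m := 1) (by norm_cast; omega))
  have h0' : ContDiffAt ℝ 1 (fderiv ℝ F) y₀ := h0.fderiv_right (by norm_cast; omega)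
  obtain ⟨L₂, r₂, hr₂, hL₂⟩ := exists_lipschitz_ball_of_contDiffAt h0'
  have hpos : 0 < ‖fderiv ℝ F y₀‖ := norm_pos_iff.2 (hne y₀ hyU)
  have hev : ∀ᶠ z in nhds y₀, ‖fderiv ℝ F y₀‖ / 2 < ‖fderiv ℝ F z‖ :=
    h0'.continuousAt.norm.eventually_const_lt (half_lt_self hpos)
  obtain ⟨r₃, hr₃, hL₃⟩ := Metric.eventually_nhds_iff_ball.1 hev
  have hit : ∀ᶠ z in nhds y₀, ∀ k ∈ Finset.range (p + 2),
      ‖iteratedFDeriv ℝ k F z‖ < ‖iteratedFDeriv ℝ k F y₀‖ + 1 := by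
    rw [Filter.eventually_all_finset]
    intro k hk
    have hk' : k ≤ p + 1 := by simpa [Nat.lt_succ_iff] using hk
    exact (h0.continuousAt_iteratedFDeriv (by exact_mod_cast hk')).norm.eventually_lt_const
      (lt_add_one _)
  obtain ⟨r₄, hr₄, hL₄⟩ := Metric.eventually_nhds_iff_ball.1 hit
  set L₄ := ∑ k ∈ Finset.range (p + 2), (‖iteratedFDeriv ℝ k F y₀‖ + 1)
  set ρ := min r (min r₁ (min r₂ (min r₃ r₄)))
  have hρ : ∀ z ∈ Metric.ball y₀ ρ, z ∈ Metric.ball y₀ r ∧ z ∈ Metric.ball y₀ r₁ ∧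
      z ∈ Metric.ball y₀ r₂ ∧ z ∈ Metric.ball y₀ r₃ ∧ z ∈ Metric.ball y₀ r₄ := by
    intro z hz
    simpa only [ρ, Metric.mem_ball, lt_min_iff] using hz
  set L := |L₁| + |L₂| + 2 / ‖fderiv ℝ F y₀‖ + L₄
  have hL₄0 : 0 ≤ L₄ := Finset.sum_nonneg fun k _ => by positivity
  have hdiv : 0 < 2 / ‖fderiv ℝ F y₀‖ := by positivity
  have hL1 : L₁ ≤ L := by have := le_abs_self L₁; have := abs_nonneg L₂; linarith
  have hL2 : L₂ ≤ L := by have := le_abs_self L₂; have := abs_nonneg L₁; linarith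
  have hL3 : 2 / ‖fderiv ℝ F y₀‖ ≤ L := by have := abs_nonneg L₁; have := abs_nonneg L₂; linarith
  have hL4 : L₄ ≤ L := by have := abs_nonneg L₁; have := abs_nonneg L₂; linarith
  refine ⟨F, ρ, L, ⟨by positivity, by linarith, fun z hz => hFat z (hrU (hρ z hz).1), ?_, ?_, ?_,
    ?_, ?_⟩⟩
  · intro z hz
    have hzU := hrU (hρ z hz).1
    have := Set.ext_iff.1 heq z
    simpa [hzU] using this
  · intro z hz z' hz'
    exact (hL₁ z (hρ z hz).2.1 z' (hρ z' hz').2.1).trans (by gcongr)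
  · intro z hz z' hz'
    exact (hL₂ z (hρ z hz).2.2.1 z' (hρ z' hz').2.2.1).trans (by gcongr)
  · intro z hz
    have h := hL₃ z (hρ z hz).2.2.2.1
    calc (1 : ℝ) = 2 / ‖fderiv ℝ F y₀‖ * (‖fderiv ℝ F y₀‖ / 2) := by field_simp
      _ ≤ L * ‖fderiv ℝ F z‖ := by gcongr
  · intro k hk z hz
    have hk' : k ∈ Finset.range (p + 2) := by simp; omega
    refine ((hL₄ z (hρ z hz).2.2.2.2 k hk').le.trans ?_).trans hL4
    exact Finset.single_le_sum (f := fun k => ‖iteratedFDeriv ℝ k F y₀‖ + 1)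
      (fun k _ => by positivity) hk'

/-- The implicit function parameterizes the level set over the kernel of the differential, and its
derivative at 0 is the inclusion of that kernel. Derivatives map tangent cones to tangent cones. -/
theorem mem_tangentConeAt_of_fderiv_eq_zero {F : Space → ℝ} {y τ : Space}
    (hF : ContDiffAt ℝ 1 F y) (hne : fderiv ℝ F y ≠ 0) (hτ : fderiv ℝ F y τ = 0)
    {Γ : Set Space} (hΓ : ∀ᶠ z in nhds y, F z = F y → z ∈ Γ) : τ ∈ tangentConeAt ℝ Γ y := by
  have hs := hF.hasStrictFDerivAt one_ne_zero
  have hrange : (fderiv ℝ F y).range = ⊤ := by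
    rw [LinearMap.range_eq_top]
    exact LinearMap.surjective (f := (fderiv ℝ F y : Space →ₗ[ℝ] ℝ))
      (fun h => hne (ContinuousLinearMap.coe_injective h))
  set φ := hs.implicitFunction F _ hrange (F y)
  have hφ := hs.to_implicitFunction hrange
  have h0 : φ 0 = y := hs.implicitFunction_apply_image hrange
  have hlev : ∀ᶠ q in nhds (0 : (fderiv ℝ F y).ker), F (φ q) = F y := by
    have h := hs.map_implicitFunction_eq hrange
    have hc : Filter.Tendsto (fun q : (fderiv ℝ F y).ker => (F y, q)) (nhds 0) (nhds (F y, 0)) :=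
      (Continuous.prodMk_right (F y)).tendsto 0
    exact hc.eventually h
  have hmem : ∀ᶠ q in nhds (0 : (fderiv ℝ F y).ker), φ q ∈ Γ := by
    have hc : Filter.Tendsto φ (nhds 0) (nhds y) := by
      have := hφ.hasFDerivAt.continuousAt.tendsto
      change Filter.Tendsto φ (nhds 0) (nhds (φ 0)) at this
      rwa [h0] at this
    filter_upwards [hlev, hc.eventually hΓ] with q h1 h2 using h2 h1
  have hd : HasFDerivWithinAt φ (fderiv ℝ F y).ker.subtypeL {q | φ q ∈ Γ} 0 :=
    hφ.hasFDerivAt.hasFDerivWithinAt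
  have hmaps := hd.mapsTo_tangent_cone
  rw [tangentConeAt_of_mem_nhds hmem] at hmaps
  have := hmaps (Set.mem_univ ⟨τ, hτ⟩)
  rw [h0] at this
  exact tangentConeAt_mono (by rintro _ ⟨q, hq, rfl⟩; exact hq) this

variable {Γ : Set Space} {n : ℕ} {F : Space → ℝ} {y₀ : Space} {ρ L : ℝ}

theorem IsLocalEquation.fderiv_ne_zero (h : IsLocalEquation Γ n F y₀ ρ L) {z : Space}
    (hz : z ∈ Metric.ball y₀ ρ) : fderiv ℝ F z ≠ 0 := by
  intro h0
  have := h.one_le_fderiv z hz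
  rw [h0, norm_zero, mul_zero] at this
  linarith

/-- Unit normals are multiples of the gradient of a local equation. -/
theorem IsLocalEquation.exists_eq_mul_fderiv (h : IsLocalEquation Γ n F y₀ ρ L) (hn : 1 ≤ n)
    {y ν : Space} (hy : y ∈ Metric.ball y₀ ρ) (hyΓ : y ∈ Γ) (hν : IsUnitNormal Γ y ν) :
    ∃ c : ℝ, |c| ≤ L ∧ |c| * ‖fderiv ℝ F y‖ = 1 ∧ ∀ x, ⟪ν, x⟫ = c * fderiv ℝ F y x := by
  have hF : ContDiffAt ℝ 1 F y := (h.contDiffAt y hy).of_le (by exact_mod_cast hn)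
  have hne := h.fderiv_ne_zero hy
  have hFy : F y = 0 := (h.mem_iff y hy).1 hyΓ
  have hev : ∀ᶠ z in nhds y, F z = F y → z ∈ Γ := by
    filter_upwards [Metric.isOpen_ball.mem_nhds hy] with z hz hFz
    exact (h.mem_iff z hz).2 (hFz.trans hFy)
  set g : Space := (InnerProductSpace.toDual ℝ Space).symm (fderiv ℝ F y)
  have hg : ∀ x, ⟪g, x⟫ = fderiv ℝ F y x := fun x =>
    InnerProductSpace.toDual_symm_apply
  have hgn : ‖g‖ = ‖fderiv ℝ F y‖ := LinearIsometryEquiv.norm_map _ _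
  have hg0 : ‖g‖ ≠ 0 := by rw [hgn]; exact norm_ne_zero_iff.2 hne
  -- The coefficient of the orthogonal projection of `ν` onto the gradient `g`. The remainder `ν - c
  -- • g` is tangent, hence orthogonal to `ν` and to `g`, hence zero.
  set c := ⟪g, ν⟫ / ‖g‖ ^ 2
  have hker : fderiv ℝ F y (ν - c • g) = 0 := by
    rw [← hg, inner_sub_right, inner_smul_right, real_inner_self_eq_norm_sq]
    simp only [c]
    field_simp
    ring
  have hperp := hν.2 _ (mem_tangentConeAt_of_fderiv_eq_zero hF hne hker hev)
  have heq : ν = c • g := by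
    rw [← sub_eq_zero, ← norm_eq_zero, ← sq_eq_zero_iff, ← real_inner_self_eq_norm_sq]
    conv_lhs => rw [inner_sub_left, hperp, inner_smul_left, hg, hker]
    simp
  have h1 : |c| * ‖fderiv ℝ F y‖ = 1 := by
    rw [← hgn, ← hν.1]
    conv_rhs => rw [heq, norm_smul, Real.norm_eq_abs]
  refine ⟨c, ?_, h1, fun x => ?_⟩
  · have h2 := h.one_le_fderiv y hy
    have h3 : 0 < ‖fderiv ℝ F y‖ := norm_pos_iff.2 hne
    rw [← h1] at h2
    exact le_of_mul_le_mul_right h2 h3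
  · rw [← hg]
    conv_lhs => rw [heq, inner_smul_left]
    simp

/-- The normals of `Γ` close to `y₀` are close to one of two opposite unit vectors. -/
theorem IsLocalEquation.exists_normal (h : IsLocalEquation Γ n F y₀ ρ L) (hn : 1 ≤ n) :
    ∃ n₀ : Space, ‖n₀‖ = 1 ∧ fderiv ℝ F y₀ n₀ ≠ 0 ∧ ∀ η > 0, ∃ δ > 0, ∀ y ∈ Γ, dist y y₀ < δ →
      ∀ ν, IsUnitNormal Γ y ν → ‖ν - n₀‖ < η ∨ ‖ν + n₀‖ < η := by
  have hy₀ : y₀ ∈ Metric.ball y₀ ρ := Metric.mem_ball_self h.radius_pos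
  set G : Space → Space := fun y => (InnerProductSpace.toDual ℝ Space).symm (fderiv ℝ F y)
  have hG : ∀ y x, ⟪G y, x⟫ = fderiv ℝ F y x := fun y x => InnerProductSpace.toDual_symm_apply
  have hGn : ∀ y, ‖G y‖ = ‖fderiv ℝ F y‖ := fun y => LinearIsometryEquiv.norm_map _ _
  have hG0 : 0 < ‖G y₀‖ := by
    rw [hGn]; exact norm_pos_iff.2 (h.fderiv_ne_zero hy₀)
  have hcont : ContinuousAt (fun y => ‖G y‖⁻¹ • G y) y₀ := by
    have h1 : ContinuousAt (fderiv ℝ F) y₀ :=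
      ((h.contDiffAt y₀ hy₀).fderiv_right (m := 0) (by exact_mod_cast hn)).continuousAt
    have h2 : ContinuousAt G y₀ :=
      (LinearIsometryEquiv.continuous _).continuousAt.comp h1
    exact (h2.norm.inv₀ hG0.ne').smul h2
  refine ⟨‖G y₀‖⁻¹ • G y₀, ?_, ?_, ?_⟩
  · rw [norm_smul, norm_inv, norm_norm, inv_mul_cancel₀ hG0.ne']
  · rw [map_smul, ← hG, real_inner_self_eq_norm_sq, smul_eq_mul]
    positivity
  · intro η hη
    obtain ⟨δ, hδ, hball⟩ := Metric.eventually_nhds_iff_ball.1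
      (hcont.eventually (Metric.ball_mem_nhds _ hη))
    refine ⟨min δ ρ, lt_min hδ h.radius_pos, fun y hyΓ hy ν hν => ?_⟩
    obtain ⟨c, -, hc1, hc⟩ := h.exists_eq_mul_fderiv hn
      (Metric.mem_ball.2 (hy.trans_le (min_le_right _ _))) hyΓ hν
    have hνG : ν = c • G y := by
      refine ext_inner_right ℝ fun x => ?_
      rw [hc, inner_smul_left, hG]
      rfl
    have hball := hball y (Metric.mem_ball.2 (hy.trans_le (min_le_left _ _)))
    rw [dist_eq_norm] at hball
    rw [← hGn] at hc1
    have habs : |c| = ‖G y‖⁻¹ := eq_inv_of_mul_eq_one_left hc1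
    -- The modulus of `c` is fixed by normalization; only the sign of the normal is free.
    rcases abs_choice c with hs | hs
    · left
      rw [hνG, ← hs, habs]
      exact hball
    · right
      rw [hνG, show c = -‖G y‖⁻¹ by rw [← habs, hs, neg_neg], neg_smul, neg_add_eq_sub,
        norm_sub_rev]
      exact hball

end LocalEquations

/-! ### Graph charts with variable base point, direction and level -/

section GraphCharts

/-- Parameters of a graph chart: a point, a direction and a level. -/
abbrev ChartParam := Space × Space × ℝ

/-- `ψ (a, m, ε)` is the height over `a`, in the direction `m`, of the level set `F = ε`, for
parameters in the ball of radius `η` around `(y₀, m₀, 0)`. -/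
structure IsGraphChart (n : ℕ) (F : Space → ℝ) (y₀ m₀ : Space) (ρ : ℝ) (ψ : ChartParam → ℝ)
    (η L : ℝ) : Prop where
  radius_pos : 0 < η
  bound_pos : 0 < L
  contDiffAt : ∀ e ∈ Metric.ball (y₀, m₀, (0 : ℝ)) η, ContDiffAt ℝ n ψ e
  iteratedFDeriv_le : ∀ e ∈ Metric.ball (y₀, m₀, (0 : ℝ)) η, ‖iteratedFDeriv ℝ n ψ e‖ ≤ L
  lipschitz : ∀ e ∈ Metric.ball (y₀, m₀, (0 : ℝ)) η, ∀ e' ∈ Metric.ball (y₀, m₀, (0 : ℝ)) η,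
    |ψ e - ψ e'| ≤ L * dist e e'
  mem_ball : ∀ e ∈ Metric.ball (y₀, m₀, (0 : ℝ)) η, e.1 + ψ e • e.2.1 ∈ Metric.ball y₀ ρ
  apply_eq : ∀ e ∈ Metric.ball (y₀, m₀, (0 : ℝ)) η, F (e.1 + ψ e • e.2.1) = e.2.2
  unique : ∀ a m w, dist a y₀ < η → dist m m₀ < η → |w| < η → |F (a + w • m)| < η →
    ψ (a, m, F (a + w • m)) = w

theorem mem_ball_chartParam {y₀ m₀ a m : Space} {ε η : ℝ} :
    ((a, m, ε) : ChartParam) ∈ Metric.ball (y₀, m₀, (0 : ℝ)) η ↔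
      dist a y₀ < η ∧ dist m m₀ < η ∧ |ε| < η := by
  rw [Metric.mem_ball, Prod.dist_eq, Prod.dist_eq, max_lt_iff, max_lt_iff, Real.dist_0_eq_abs]

theorem isInvertible_of_apply_one_ne_zero {f : ℝ →L[ℝ] ℝ} (hf : f 1 ≠ 0) : f.IsInvertible :=
  ⟨ContinuousLinearEquiv.unitsEquivAut ℝ (Units.mk0 (f 1) hf), by ext; simp⟩

/-- The implicit function theorem applies to `F (a + w • m) - ε = 0`, solved for `w`: the derivative
in `w` at the base parameters is `fderiv ℝ F y₀ m₀`. With `a`, `m` and `ε` all as parameters, the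
bounds are uniform over the moving frames. -/
theorem IsLocalEquation.exists_isGraphChart {Γ : Set Space} {n : ℕ} {F : Space → ℝ}
    {y₀ m₀ : Space} {ρ L : ℝ} (h : IsLocalEquation Γ n F y₀ ρ L) (hn : 1 ≤ n) (hy₀ : y₀ ∈ Γ)
    (hm₀ : fderiv ℝ F y₀ m₀ ≠ 0) : ∃ ψ η L', IsGraphChart n F y₀ m₀ ρ ψ η L' := by
  have hn0 : (n : WithTop ℕ∞) ≠ 0 := by exact_mod_cast (by omega : n ≠ 0)
  have hball : y₀ ∈ Metric.ball y₀ ρ := Metric.mem_ball_self h.radius_pos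
  have hF := h.contDiffAt y₀ hball
  have hF0 : F y₀ = 0 := (h.mem_iff y₀ hball).1 hy₀
  let f : ChartParam × ℝ → ℝ := fun v => F (v.1.1 + v.2 • v.1.2.1) - v.1.2.2
  let e₀ : ChartParam := (y₀, m₀, 0)
  have hfu : f (e₀, 0) = 0 := by simp [f, e₀, hF0]
  have hf : ContDiffAt ℝ n f (e₀, 0) := by
    have h1 : ContDiffAt ℝ n (fun v : ChartParam × ℝ => v.1.1 + v.2 • v.1.2.1) (e₀, 0) := by
      fun_prop
    have h2 : ContDiffAt ℝ n (fun v : ChartParam × ℝ => v.1.2.2) (e₀, 0) := by fun_prop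
    refine ContDiffAt.sub (ContDiffAt.comp (e₀, (0 : ℝ)) ?_ h1) h2
    simpa [e₀] using hF
  have hinv : (fderiv ℝ f (e₀, 0) ∘L .inr ℝ ChartParam ℝ).IsInvertible := by
    apply isInvertible_of_apply_one_ne_zero
    have h1 : HasDerivAt (fun t : ℝ => f (e₀, t)) (fderiv ℝ f (e₀, 0) (0, 1)) 0 := by
      refine (hf.differentiableAt hn0).hasFDerivAt.comp_hasDerivAt (0 : ℝ) ?_
      exact (hasDerivAt_const (0 : ℝ) e₀).prodMk (hasDerivAt_id (0 : ℝ))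
    have h2 : HasDerivAt (fun t : ℝ => f (e₀, t)) (fderiv ℝ F y₀ m₀) 0 := by
      have h3 : HasDerivAt (fun t : ℝ => y₀ + t • m₀) m₀ 0 := by
        simpa using ((hasDerivAt_id (0 : ℝ)).smul_const m₀).const_add y₀
      have h4 : HasFDerivAt F (fderiv ℝ F y₀) (y₀ + (0 : ℝ) • m₀) := by
        rw [zero_smul, add_zero]
        exact (hF.differentiableAt hn0).hasFDerivAt
      simpa [f, e₀, Function.comp_def] using h4.comp_hasDerivAt (0 : ℝ) h3
    simpa [← h1.unique h2] using hm₀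
  set ψ := hf.implicitFunction hn0 hinv
  have hψ0 : ψ e₀ = 0 := hf.implicitFunction_apply_self hn0 hinv
  have hψ : ContDiffAt ℝ n ψ e₀ := hf.contDiffAt_implicitFunction hn0 hinv
  obtain ⟨L₁, r₁, hr₁, hL₁⟩ := exists_lipschitz_ball_of_contDiffAt
    (hψ.of_le (m := 1) (by exact_mod_cast hn))
  have hev : ∀ᶠ e in nhds e₀, ContDiffAt ℝ n ψ e ∧
      ‖iteratedFDeriv ℝ n ψ e‖ < ‖iteratedFDeriv ℝ n ψ e₀‖ + 1 ∧
      e.1 + ψ e • e.2.1 ∈ Metric.ball y₀ ρ ∧ f (e, ψ e) = f (e₀, 0) := by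
    refine (hψ.eventually (WithTop.coe_injective.ne (ENat.natCast_ne_top n))).and
      (((hψ.continuousAt_iteratedFDeriv le_rfl).norm.eventually_lt_const (lt_add_one _)).and
      (Filter.Eventually.and ?_ (hf.eventually_apply_implicitFunction hn0 hinv)))
    have hc : ContinuousAt (fun e : ChartParam => e.1 + ψ e • e.2.1) e₀ := by
      have := hψ.continuousAt
      fun_prop
    refine hc.eventually_mem (Metric.isOpen_ball.mem_nhds ?_)
    rw [hψ0]
    simpa [e₀] using h.radius_pos
  obtain ⟨r₂, hr₂, hev⟩ := Metric.eventually_nhds_iff_ball.1 hev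
  obtain ⟨r₃, hr₃, huniq⟩ := Metric.eventually_nhds_iff_ball.1
    (hf.eventually_apply_eq_iff_implicitFunction hn0 hinv)
  set η := min r₁ (min r₂ r₃)
  have h1 : ∀ e ∈ Metric.ball e₀ η, e ∈ Metric.ball e₀ r₁ := fun e he =>
    Metric.ball_subset_ball (min_le_left _ _) he
  have h2 : ∀ e ∈ Metric.ball e₀ η, e ∈ Metric.ball e₀ r₂ := fun e he =>
    Metric.ball_subset_ball ((min_le_right _ _).trans (min_le_left _ _)) he
  have h3 : η ≤ r₃ := (min_le_right _ _).trans (min_le_right _ _)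
  have hpos : 0 ≤ ‖iteratedFDeriv ℝ n ψ e₀‖ := norm_nonneg _
  have habs := abs_nonneg L₁
  refine ⟨ψ, η, |L₁| + (‖iteratedFDeriv ℝ n ψ e₀‖ + 1), ⟨by positivity, by positivity,
    fun e he => (hev e (h2 e he)).1, fun e he => ?_, fun e he e' he' => ?_,
    fun e he => (hev e (h2 e he)).2.2.1, fun e he => ?_, fun a m w ha hm hw hFw => ?_⟩⟩
  · have := (hev e (h2 e he)).2.1
    linarith
  · refine (hL₁ e (h1 e he) e' (h1 e' he')).trans ?_
    gcongr
    have := le_abs_self L₁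
    linarith
  · have := (hev e (h2 e he)).2.2.2
    rw [hfu] at this
    exact sub_eq_zero.1 this
  · have hmem : (((a, m, F (a + w • m)), w) : ChartParam × ℝ) ∈ Metric.ball (e₀, (0 : ℝ)) r₃ := by
      rw [Metric.mem_ball, Prod.dist_eq, max_lt_iff, Real.dist_0_eq_abs, ← Metric.mem_ball,
        mem_ball_chartParam]
      exact ⟨⟨ha.trans_le h3, hm.trans_le h3, hFw.trans_le h3⟩, hw.trans_le h3⟩
    exact (huniq _ hmem).1 (by rw [hfu]; simp [f])

/-- The implicit function rule for the slopes of a graph chart. -/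
theorem IsGraphChart.fderiv_apply {Γ : Set Space} {n : ℕ} {F : Space → ℝ} {y₀ m₀ : Space}
    {ρ L η L' : ℝ} {ψ : ChartParam → ℝ} (hψ : IsGraphChart n F y₀ m₀ ρ ψ η L')
    (h : IsLocalEquation Γ n F y₀ ρ L) (hn : 1 ≤ n) {e : ChartParam}
    (he : e ∈ Metric.ball (y₀, m₀, (0 : ℝ)) η) (τ : Space) :
    fderiv ℝ F (e.1 + ψ e • e.2.1) τ +
      fderiv ℝ ψ e (τ, 0, 0) * fderiv ℝ F (e.1 + ψ e • e.2.1) e.2.1 = 0 := by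
  have hn0 : (n : WithTop ℕ∞) ≠ 0 := by exact_mod_cast (by omega : n ≠ 0)
  have hline : HasDerivAt (fun t : ℝ => e + t • ((τ, 0, 0) : ChartParam)) (τ, 0, 0) 0 := by
    simpa using ((hasDerivAt_id (0 : ℝ)).smul_const ((τ, 0, 0) : ChartParam)).const_add e
  have hψd : HasDerivAt (fun t : ℝ => ψ (e + t • ((τ, 0, 0) : ChartParam)))
      (fderiv ℝ ψ e (τ, 0, 0)) 0 := by
    have h1 : HasFDerivAt ψ (fderiv ℝ ψ e) (e + (0 : ℝ) • ((τ, 0, 0) : ChartParam)) := by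
      rw [zero_smul, add_zero]
      exact ((hψ.contDiffAt e he).differentiableAt hn0).hasFDerivAt
    exact h1.comp_hasDerivAt (0 : ℝ) hline
  have hcurve : HasDerivAt
      (fun t : ℝ => e.1 + t • τ + ψ (e + t • ((τ, 0, 0) : ChartParam)) • e.2.1)
      (τ + fderiv ℝ ψ e (τ, 0, 0) • e.2.1) 0 := by
    refine HasDerivAt.add ?_ (hψd.smul_const e.2.1)
    simpa using ((hasDerivAt_id (0 : ℝ)).smul_const τ).const_add e.1
  have hFd : HasDerivAt
      (fun t : ℝ => F (e.1 + t • τ + ψ (e + t • ((τ, 0, 0) : ChartParam)) • e.2.1))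
      (fderiv ℝ F (e.1 + ψ e • e.2.1) (τ + fderiv ℝ ψ e (τ, 0, 0) • e.2.1)) 0 := by
    have h1 : HasFDerivAt F (fderiv ℝ F (e.1 + ψ e • e.2.1))
        (e.1 + (0 : ℝ) • τ + ψ (e + (0 : ℝ) • ((τ, 0, 0) : ChartParam)) • e.2.1) := by
      rw [zero_smul, zero_smul, add_zero, add_zero]
      exact ((h.contDiffAt _ (hψ.mem_ball e he)).differentiableAt hn0).hasFDerivAt
    exact h1.comp_hasDerivAt (0 : ℝ) hcurve
  -- The curve over `a + t • τ` stays in one level set, so the derivative of `F` along it vanishes.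
  have hconst : (fun t : ℝ => F (e.1 + t • τ + ψ (e + t • ((τ, 0, 0) : ChartParam)) • e.2.1))
      =ᶠ[nhds 0] fun _ => e.2.2 := by
    have hc : Filter.Tendsto (fun t : ℝ => e + t • ((τ, 0, 0) : ChartParam)) (nhds 0) (nhds e) := by
      simpa using hline.continuousAt.tendsto
    filter_upwards [hc.eventually (Metric.isOpen_ball.mem_nhds he)] with t ht
    simpa using hψ.apply_eq _ ht
  have := hFd.unique ((hasDerivAt_const (0 : ℝ) e.2.2).congr_of_eventuallyEq hconst)
  rwa [map_add, map_smul, smul_eq_mul] at this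

theorem IsGraphChart.norm_fderiv_le {n : ℕ} {F : Space → ℝ} {y₀ m₀ : Space} {ρ η L : ℝ}
    {ψ : ChartParam → ℝ} (hψ : IsGraphChart n F y₀ m₀ ρ ψ η L) {e : ChartParam}
    (he : e ∈ Metric.ball (y₀, m₀, (0 : ℝ)) η) : ‖fderiv ℝ ψ e‖ ≤ L := by
  refine norm_fderiv_le_of_lip' ℝ hψ.bound_pos.le ?_
  filter_upwards [Metric.isOpen_ball.mem_nhds he] with e' he'
  simpa [dist_eq_norm] using hψ.lipschitz e' he' e he

end GraphCharts

/-! ### The Taylor polynomial as a near-solution of the fitting equations -/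

section FitCompetitor

namespace LocalFrame

variable {Q : LocalFrame}

theorem IsOrthonormal.norm_s (hQ : Q.IsOrthonormal) : ‖Q.s‖ = 1 := hQ.1 0

theorem IsOrthonormal.norm_t (hQ : Q.IsOrthonormal) : ‖Q.t‖ = 1 := hQ.1 1

theorem IsOrthonormal.norm_m (hQ : Q.IsOrthonormal) : ‖Q.m‖ = 1 := hQ.1 2

theorem IsOrthonormal.eq_add (hQ : Q.IsOrthonormal) (x : Space) :
    x = Q.origin + (Q.u x • Q.s + Q.v x • Q.t) + Q.w x • Q.m := by
  have hspan : ⊤ ≤ Submodule.span ℝ (Set.range ![Q.s, Q.t, Q.m]) := by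
    have := hQ.linearIndependent.span_eq_top_of_card_eq_finrank' (by simp)
    exact this.ge
  have hon : Orthonormal ℝ ![Q.s, Q.t, Q.m] := hQ
  have h := (OrthonormalBasis.mk hon hspan).sum_repr' (x - Q.origin)
  rw [Fin.sum_univ_three, OrthonormalBasis.coe_mk] at h
  rw [add_assoc, ← sub_eq_iff_eq_add']
  exact h.symm

theorem IsOrthonormal.abs_u_le (hQ : Q.IsOrthonormal) (x : Space) : |Q.u x| ≤ ‖x - Q.origin‖ := by
  simpa [u, hQ.norm_s] using abs_real_inner_le_norm Q.s (x - Q.origin)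

theorem IsOrthonormal.abs_v_le (hQ : Q.IsOrthonormal) (x : Space) : |Q.v x| ≤ ‖x - Q.origin‖ := by
  simpa [v, hQ.norm_t] using abs_real_inner_le_norm Q.t (x - Q.origin)

theorem IsOrthonormal.abs_w_le (hQ : Q.IsOrthonormal) (x : Space) : |Q.w x| ≤ ‖x - Q.origin‖ := by
  simpa [w, hQ.norm_m] using abs_real_inner_le_norm Q.m (x - Q.origin)

end LocalFrame

variable {Γ : Set Space} {n : ℕ} {F : Space → ℝ} {y₀ m₀ : Space} {ρ L η L' : ℝ}
  {ψ : ChartParam → ℝ}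

/-- A mesh vertex off `Γ` lies exactly on the level set of its own value of `F`, which is at most
`L` times its distance to `y`. Passing from that level to level 0 changes the height by a Lipschitz
amount. -/
theorem IsGraphChart.abs_sub_le (hψ : IsGraphChart n F y₀ m₀ ρ ψ η L')
    (h : IsLocalEquation Γ n F y₀ ρ L) {a m y : Space} {w : ℝ} (ha : dist a y₀ < η)
    (hm : dist m m₀ < η) (hw : |w| < η) (hX : a + w • m ∈ Metric.ball y₀ ρ)
    (hy : y ∈ Metric.ball y₀ ρ) (hyΓ : y ∈ Γ) (hd : L * dist (a + w • m) y < η) :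
    |ψ (a, m, 0) - w| ≤ L' * (L * dist (a + w • m) y) := by
  have hF : |F (a + w • m)| ≤ L * dist (a + w • m) y := by
    have := h.lipschitz _ hX y hy
    rwa [(h.mem_iff y hy).1 hyΓ, sub_zero] at this
  have hFη := hF.trans_lt hd
  have hw' := hψ.unique a m w ha hm hw hFη
  have hlip := hψ.lipschitz (a, m, 0)
    (mem_ball_chartParam.2 ⟨ha, hm, by simpa using hψ.radius_pos⟩) (a, m, F (a + w • m))
    (mem_ball_chartParam.2 ⟨ha, hm, hFη⟩)
  rw [hw'] at hlip
  refine hlip.trans (mul_le_mul_of_nonneg_left ?_ hψ.bound_pos.le)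
  simpa [Prod.dist_eq, Real.dist_eq] using hF

/-- The slope of a graph chart compared with the slope given by an approximate normal. -/
theorem IsGraphChart.abs_slope_add_le (hψ : IsGraphChart n F y₀ m₀ ρ ψ η L')
    (h : IsLocalEquation Γ n F y₀ ρ L) (hn : 1 ≤ n) {a m y τ ν v : Space} {ε : ℝ}
    (he : (a, m, (0 : ℝ)) ∈ Metric.ball (y₀, m₀, (0 : ℝ)) η) (hy : y ∈ Metric.ball y₀ ρ)
    (hyΓ : y ∈ Γ) (hm1 : ‖m‖ = 1) (hτ : ‖τ‖ = 1) (hν : IsUnitNormal Γ y ν) (hv : ‖v - ν‖ ≤ ε)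
    (hmv : 1 / 2 ≤ |⟪m, v⟫|) :
    |fderiv ℝ ψ (a, m, 0) (τ, 0, 0) + ⟪τ, v⟫ / ⟪m, v⟫| ≤
      2 * ((1 + L') * (ε + L ^ 2 * dist (a + ψ (a, m, 0) • m) y)) := by
  obtain ⟨c, hc, -, hcν⟩ := h.exists_eq_mul_fderiv hn hy hyΓ hν
  set z := a + ψ (a, m, 0) • m
  have hz : z ∈ Metric.ball y₀ ρ := hψ.mem_ball (a, m, 0) he
  set β := fderiv ℝ ψ (a, m, 0) (τ, 0, 0)
  have hrule : fderiv ℝ F z τ + β * fderiv ℝ F z m = 0 := hψ.fderiv_apply h hn (e := (a, m, 0)) he τ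
  have hβ : |β| ≤ L' := by
    have h1 := (fderiv ℝ ψ (a, m, 0)).le_opNorm (τ, 0, 0)
    have h2 : ‖((τ, 0, 0) : ChartParam)‖ = 1 := by simp [Prod.norm_def, hτ]
    rw [h2, mul_one] at h1
    exact h1.trans (hψ.norm_fderiv_le he)
  set δ := ε + L ^ 2 * dist z y
  -- The approximate normal `v` is compared with `c` times the gradient at `z`, whose slope ratio is
  -- exactly `-β` by `hrule`.
  have hclose : ∀ x : Space, ‖x‖ = 1 → |⟪x, v⟫ - c * fderiv ℝ F z x| ≤ δ := by
    intro x hx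
    have e : ⟪x, v⟫ - c * fderiv ℝ F z x =
        ⟪x, v - ν⟫ - c * ((fderiv ℝ F z - fderiv ℝ F y) x) := by
      rw [inner_sub_right, real_inner_comm ν x, hcν, sub_apply]
      ring
    rw [e]
    refine (abs_sub _ _).trans (add_le_add ?_ ?_)
    · have := abs_real_inner_le_norm x (v - ν)
      rw [hx, one_mul] at this
      exact this.trans hv
    · rw [abs_mul]
      have h1 := (fderiv ℝ F z - fderiv ℝ F y).le_opNorm x
      rw [hx, mul_one, Real.norm_eq_abs] at h1
      calc |c| * |(fderiv ℝ F z - fderiv ℝ F y) x| ≤ L * (L * dist z y) := by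
            refine mul_le_mul hc (h1.trans (h.fderiv_lipschitz z hz y hy)) (abs_nonneg _)
              h.bound_pos.le
        _ = _ := by ring
  have hmv0 : ⟪m, v⟫ ≠ 0 := by
    intro h0
    rw [h0, abs_zero] at hmv
    norm_num at hmv
  have e : β + ⟪τ, v⟫ / ⟪m, v⟫ = ((⟪τ, v⟫ - c * fderiv ℝ F z τ) +
      β * (⟪m, v⟫ - c * fderiv ℝ F z m)) / ⟪m, v⟫ := by
    rw [eq_div_iff hmv0, add_mul, div_mul_cancel₀ _ hmv0]
    linear_combination c * hrule
  have hδ : 0 ≤ δ := (abs_nonneg _).trans (hclose τ hτ)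
  rw [e, abs_div, div_le_iff₀ (by linarith)]
  calc _ ≤ |⟪τ, v⟫ - c * fderiv ℝ F z τ| + |β * (⟪m, v⟫ - c * fderiv ℝ F z m)| := abs_add_le _ _
    _ ≤ δ + L' * δ := by
        rw [abs_mul]
        exact add_le_add (hclose τ hτ) (mul_le_mul hβ (hclose m hm1) (abs_nonneg _)
          hψ.bound_pos.le)
    _ = 2 * ((1 + L') * δ) * (1 / 2) := by ring
    _ ≤ _ := by
        refine mul_le_mul_of_nonneg_left hmv ?_
        have := hψ.bound_pos
        positivity

/-- In a local frame whose normal is close to `m₀`, a polynomial that is nearly a solution of the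
fitting equations. -/
theorem IsGraphChart.exists_competitor (hψ : IsGraphChart (n + 2) F y₀ m₀ ρ ψ η L')
    (h : IsLocalEquation Γ (n + 2) F y₀ ρ L) {Q : LocalFrame} (hQ : Q.IsOrthonormal)
    {t R Cx Cn σ : ℝ} (ht : 0 < t) (ht1 : t ≤ 1) (hm : dist Q.m m₀ < η)
    (hCx : 0 ≤ Cx)
    (hb : dist Q.origin y₀ ≤ σ) (hR : R * t ≤ σ) (hσ : Cx * t ^ (n + 2) ≤ σ)
    (hLσ : L * (Cx * t ^ (n + 2)) < η) (hση : 4 * σ < η) (hσρ : 4 * σ < ρ) :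
    ∃ d : MonoIdx (n + 1) → ℝ, d (MonoIdx.zero (n + 1)) = ψ (Q.origin, Q.m, 0) ∧
      ∀ X y : Space, y ∈ Γ → ‖X - Q.origin‖ ≤ R * t → ‖X - y‖ ≤ Cx * t ^ (n + 2) →
        |∑ a, (Q.u X / t) ^ a.1.1.val * (Q.v X / t) ^ a.1.2.val * d a - Q.w X| ≤
          (L' * L * Cx + L' * (2 * R) ^ (n + 2)) * t ^ (n + 2) ∧
        ∀ ν v : Space, IsUnitNormal Γ y ν → ‖v - ν‖ ≤ Cn * t ^ (n + 1) → 1 / 2 ≤ |⟪Q.m, v⟫| →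
          |∑ a, (a.1.1.val : ℝ) * (Q.u X / t) ^ (a.1.1.val - 1) * (Q.v X / t) ^ a.1.2.val * d a -
              -(t * ⟪Q.s, v⟫ / ⟪Q.m, v⟫)| ≤
            (2 * ((1 + L') * (Cn + L ^ 2 * (L' * L * Cx + Cx))) + L' * (2 * R) ^ (n + 1)) *
              t ^ (n + 2) ∧
          |∑ a, (a.1.2.val : ℝ) * (Q.u X / t) ^ a.1.1.val * (Q.v X / t) ^ (a.1.2.val - 1) * d a -
              -(t * ⟪Q.t, v⟫ / ⟪Q.m, v⟫)| ≤
            (2 * ((1 + L') * (Cn + L ^ 2 * (L' * L * Cx + Cx))) + L' * (2 * R) ^ (n + 1)) *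
              t ^ (n + 2) := by
  have hη := hψ.radius_pos
  have hL := h.bound_pos
  have hL' := hψ.bound_pos
  have hσ0 : 0 ≤ σ := dist_nonneg.trans hb
  set e : ChartParam := (Q.origin, Q.m, 0)
  have he : e ∈ Metric.ball (y₀, m₀, (0 : ℝ)) η :=
    mem_ball_chartParam.2 ⟨by linarith, hm, by simpa using hη⟩
  -- Directions of length `t` make these the coefficients in the rescaled variables `u / t` and `v /
  -- t`. The fitting degree is `n + 1`.
  obtain ⟨d, hd0, hd, hdu, hdv⟩ := exists_taylorSum_coeff (n := n)
    ((hψ.contDiffAt e he).of_le (by norm_cast; omega)) ((t • Q.s, 0, 0) : ChartParam)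
    ((t • Q.t, 0, 0) : ChartParam)
  refine ⟨d, hd0, fun X y hyΓ hXb hXy => ?_⟩
  have hRt : 0 ≤ R * t := (norm_nonneg _).trans hXb
  have hR0 : 0 ≤ R := nonneg_of_mul_nonneg_left hRt ht
  set x : Space := Q.u X • Q.s + Q.v X • Q.t
  have hxn : ‖x‖ ≤ 2 * R * t := by
    refine (norm_add_le _ _).trans ?_
    rw [norm_smul, norm_smul, hQ.norm_s, hQ.norm_t, mul_one, mul_one, Real.norm_eq_abs,
      Real.norm_eq_abs]
    have h1 := hQ.abs_u_le X
    have h2 := hQ.abs_v_le X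
    linarith
  have hinc : (Q.u X / t) • ((t • Q.s, 0, 0) : ChartParam) +
      (Q.v X / t) • ((t • Q.t, 0, 0) : ChartParam) = (x, 0, 0) := by
    simp [x, smul_smul, div_mul_cancel₀ _ ht.ne']
  have hincn : ‖((x, 0, 0) : ChartParam)‖ ≤ 2 * R * t := by simpa [Prod.norm_def] using hxn
  -- The base is within `σ` of `y₀` and the tangential increment has length at most `2 * σ`, so `4 *
  -- σ < η` keeps the segment in the chart.
  have hseg : ∀ q ∈ segment ℝ 0 ((x, 0, 0) : ChartParam),
      e + q ∈ Metric.ball (y₀, m₀, (0 : ℝ)) η := by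
    intro q hq
    obtain ⟨r, hr, rfl⟩ := (segment_eq_image ℝ (0 : ChartParam) (x, 0, 0) ▸ hq)
    have e1 : e + ((1 - r) • (0 : ChartParam) + r • ((x, 0, 0) : ChartParam)) =
        (Q.origin + r • x, Q.m, 0) := by
      simp [e]
    dsimp only
    rw [e1, mem_ball_chartParam]
    refine ⟨?_, hm, by simpa using hη⟩
    have h1 : ‖r • x‖ ≤ 2 * R * t := by
      rw [norm_smul, Real.norm_of_nonneg hr.1]
      exact (mul_le_of_le_one_left (norm_nonneg _) hr.2).trans hxn
    have h2 : dist (Q.origin + r • x) y₀ ≤ dist Q.origin y₀ + ‖r • x‖ := by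
      rw [dist_eq_norm, dist_eq_norm, add_sub_right_comm]
      exact norm_add_le _ _
    linarith
  have heq : e + ((x, 0, 0) : ChartParam) = (Q.origin + x, Q.m, 0) := by simp [e]
  have hex : ((Q.origin + x, Q.m, 0) : ChartParam) ∈ Metric.ball (y₀, m₀, (0 : ℝ)) η :=
    heq ▸ hseg _ (right_mem_segment ℝ _ _)
  have hX : Q.origin + x + Q.w X • Q.m = X := (hQ.eq_add X).symm
  have hw : |Q.w X| < η := by
    have := hQ.abs_w_le X
    linarith
  have hXρ : X ∈ Metric.ball y₀ ρ := by
    have h1 := dist_triangle X Q.origin y₀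
    rw [dist_eq_norm X Q.origin] at h1
    rw [Metric.mem_ball]
    linarith
  have hXy' : dist X y ≤ Cx * t ^ (n + 2) := by rwa [dist_eq_norm]
  have hyρ : y ∈ Metric.ball y₀ ρ := by
    have h1 := dist_triangle y X y₀
    have h2 := dist_triangle X Q.origin y₀
    rw [dist_comm y X] at h1
    rw [dist_eq_norm X Q.origin] at h2
    rw [Metric.mem_ball]
    linarith
  have hval : |ψ (Q.origin + x, Q.m, 0) - Q.w X| ≤ L' * L * Cx * t ^ (n + 2) := by
    have h1 := hψ.abs_sub_le h (a := Q.origin + x) (m := Q.m) (y := y) (w := Q.w X)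
      (mem_ball_chartParam.1 hex).1 hm hw (by rwa [hX]) hyρ hyΓ
      (by rw [hX]; exact (mul_le_mul_of_nonneg_left hXy' hL.le).trans_lt hLσ)
    rw [hX] at h1
    calc _ ≤ L' * (L * dist X y) := h1
      _ ≤ L' * (L * (Cx * t ^ (n + 2))) := by gcongr
      _ = _ := by ring
  constructor
  · have hT := norm_sub_taylorSum_le (n + 1) (f := ψ) (a := e) (x := (x, 0, 0)) (M := L')
      (fun q hq => hψ.contDiffAt _ (hseg q hq)) (fun q hq => hψ.iteratedFDeriv_le _ (hseg q hq))
    rw [heq, ← hinc, hd, Real.norm_eq_abs, hinc, abs_sub_comm] at hT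
    have hT' : L' * ‖((x, 0, 0) : ChartParam)‖ ^ (n + 2) ≤ L' * (2 * R) ^ (n + 2) * t ^ (n + 2) := by
      rw [mul_assoc, ← mul_pow]
      gcongr
    calc _ ≤ _ := _root_.abs_sub_le _ (ψ (Q.origin + x, Q.m, 0)) _
      _ ≤ L' * (2 * R) ^ (n + 2) * t ^ (n + 2) + L' * L * Cx * t ^ (n + 2) :=
          add_le_add (hT.trans hT') hval
      _ = _ := by ring
  · intro ν v hν hv hmv
    have hz : dist (Q.origin + x + ψ (Q.origin + x, Q.m, 0) • Q.m) y ≤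
        (L' * L * Cx + Cx) * t ^ (n + 1) := by
      have h1 := dist_triangle (Q.origin + x + ψ (Q.origin + x, Q.m, 0) • Q.m) X y
      have h2 : dist (Q.origin + x + ψ (Q.origin + x, Q.m, 0) • Q.m) X =
          |ψ (Q.origin + x, Q.m, 0) - Q.w X| := by
        conv_lhs => rw [← hX]
        rw [dist_add_left, dist_eq_norm, ← sub_smul, norm_smul, hQ.norm_m, mul_one,
          Real.norm_eq_abs]
      calc _ ≤ L' * L * Cx * t ^ (n + 2) + Cx * t ^ (n + 2) := by linarith
        _ = (L' * L * Cx + Cx) * t ^ (n + 2) := by ring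
        _ ≤ _ := by
          refine mul_le_mul_of_nonneg_left ?_ (by positivity)
          exact pow_le_pow_of_le_one ht.le ht1 (by omega)
    have hT := norm_sub_taylorSum_le n (f := fderiv ℝ ψ) (a := e) (x := (x, 0, 0)) (M := L')
      (fun q hq => (hψ.contDiffAt _ (hseg q hq)).fderiv_right (by norm_cast))
      (fun q hq => by
        rw [norm_iteratedFDeriv_fderiv]
        exact hψ.iteratedFDeriv_le _ (hseg q hq))
    have hT' : L' * ‖((x, 0, 0) : ChartParam)‖ ^ (n + 1) ≤ L' * (2 * R) ^ (n + 1) * t ^ (n + 1) := by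
      rw [mul_assoc, ← mul_pow]
      gcongr
    -- Slopes are accurate only to order `t ^ (n + 1)`; the length `t` of the direction restores the
    -- order `t ^ (n + 2)` of the position rows.
    have hslope : ∀ τ : Space, ‖τ‖ = 1 →
        |taylorSum n (fderiv ℝ ψ) e (x, 0, 0) (t • τ, 0, 0) - -(t * ⟪τ, v⟫ / ⟪Q.m, v⟫)| ≤
          (2 * ((1 + L') * (Cn + L ^ 2 * (L' * L * Cx + Cx))) + L' * (2 * R) ^ (n + 1)) *
            t ^ (n + 2) := by
      intro τ hτ
      have h1 := hψ.abs_slope_add_le h (by omega) hex hyρ hyΓ hQ.norm_m hτ hν hv hmv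
      have h2 : 2 * ((1 + L') * (Cn * t ^ (n + 1) +
          L ^ 2 * dist (Q.origin + x + ψ (Q.origin + x, Q.m, 0) • Q.m) y)) ≤
          2 * ((1 + L') * (Cn + L ^ 2 * (L' * L * Cx + Cx))) * t ^ (n + 1) := by
        calc _ ≤ 2 * ((1 + L') * (Cn * t ^ (n + 1) +
              L ^ 2 * ((L' * L * Cx + Cx) * t ^ (n + 1)))) := by gcongr
          _ = _ := by ring
      have h3 : |fderiv ℝ ψ (Q.origin + x, Q.m, 0) (τ, 0, 0) -
          taylorSum n (fderiv ℝ ψ) e (x, 0, 0) (τ, 0, 0)| ≤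
          L' * (2 * R) ^ (n + 1) * t ^ (n + 1) := by
        have h4 := (fderiv ℝ ψ (e + (x, 0, 0)) -
          taylorSum n (fderiv ℝ ψ) e (x, 0, 0)).le_opNorm (τ, 0, 0)
        have h5 : ‖((τ, 0, 0) : ChartParam)‖ = 1 := by simp [Prod.norm_def, hτ]
        rw [h5, mul_one, heq] at h4
        rw [heq] at hT
        exact h4.trans (hT.trans hT')
      have e2 : taylorSum n (fderiv ℝ ψ) e (x, 0, 0) (t • τ, 0, 0) =
          t * taylorSum n (fderiv ℝ ψ) e (x, 0, 0) (τ, 0, 0) := by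
        have : ((t • τ, 0, 0) : ChartParam) = t • ((τ, 0, 0) : ChartParam) := by simp
        rw [this, map_smul, smul_eq_mul]
      rw [e2, show t * taylorSum n (fderiv ℝ ψ) e (x, 0, 0) (τ, 0, 0) -
          -(t * ⟪τ, v⟫ / ⟪Q.m, v⟫) = t * (taylorSum n (fderiv ℝ ψ) e (x, 0, 0) (τ, 0, 0) -
          fderiv ℝ ψ (Q.origin + x, Q.m, 0) (τ, 0, 0) +
          (fderiv ℝ ψ (Q.origin + x, Q.m, 0) (τ, 0, 0) + ⟪τ, v⟫ / ⟪Q.m, v⟫)) by ring,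
        abs_mul, abs_of_pos ht]
      rw [abs_sub_comm] at h3
      calc _ ≤ t * (L' * (2 * R) ^ (n + 1) * t ^ (n + 1) +
            2 * ((1 + L') * (Cn + L ^ 2 * (L' * L * Cx + Cx))) * t ^ (n + 1)) := by
            refine mul_le_mul_of_nonneg_left ?_ ht.le
            exact (abs_add_le _ _).trans (add_le_add h3 (h1.trans h2))
        _ = _ := by ring
    constructor
    · have := hslope Q.s hQ.norm_s
      rwa [← hinc, hdu] at this
    · have := hslope Q.t hQ.norm_t
      rwa [← hinc, hdv] at this

end FitCompetitor

/-! ### Accuracy of CMF and H-CMF projections -/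

section FitAccuracy

variable {N n : ℕ}

theorem LocalFit.IsCMF.abs_coeff_sub_le {p : ℕ} {A : LocalFit p N} {P : MeshPatch N} {ξ : Plane}
    {h κ ρ : ℝ} {s : ℝ≥0∞} [Fact (1 ≤ s)] (hA : A.IsCMF P ξ h)
    (hc : WellConditioned s κ (A.cmfSystem P ξ h)) (hρ : 0 ≤ ρ) {d : MonoIdx p → ℝ}
    (hd : ∀ i ∈ A.stencil, |∑ a, ((A.frame P ξ).u (P.pos i) / h) ^ a.1.1.val *
      ((A.frame P ξ).v (P.pos i) / h) ^ a.1.2.val * d a - (A.frame P ξ).w (P.pos i)| ≤ ρ)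
    (a : MonoIdx p) : |A.coeff a - d a| ≤ Fintype.card (MonoIdx p) * κ * ρ := by
  refine hA.2.abs_sub_le hc hρ (fun i => hd i i.2) (fun i => ⟨MonoIdx.zero p, ?_⟩) a
  simp [LocalFrame.pointMatrix, MonoIdx.zero]

/-- The entry 1 that each row must contain comes from the constant monomial in position rows and
from the monomial `μ` or `ν` in derivative rows; the latter require `1 ≤ p`. -/
theorem LocalFit.IsHCMF.abs_coeff_sub_le {p : ℕ} (hp : 1 ≤ p) {A : LocalFit p N} {P : MeshPatch N}
    {ξ : Plane} {h κ ρ : ℝ} {s : ℝ≥0∞} [Fact (1 ≤ s)] (hA : A.IsHCMF P ξ h)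
    (hc : WellConditioned s κ (A.hcmfSystem P ξ h)) (hρ : 0 ≤ ρ) {d : MonoIdx p → ℝ}
    (hd : ∀ i ∈ A.stencil, |∑ a, ((A.frame P ξ).u (P.pos i) / h) ^ a.1.1.val *
      ((A.frame P ξ).v (P.pos i) / h) ^ a.1.2.val * d a - (A.frame P ξ).w (P.pos i)| ≤ ρ)
    (hdu : ∀ i ∈ A.stencil, |∑ a, (a.1.1.val : ℝ) *
      ((A.frame P ξ).u (P.pos i) / h) ^ (a.1.1.val - 1) *
      ((A.frame P ξ).v (P.pos i) / h) ^ a.1.2.val * d a -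
      -(h * ⟪(A.frame P ξ).s, P.n i⟫ / ⟪(A.frame P ξ).m, P.n i⟫)| ≤ ρ)
    (hdv : ∀ i ∈ A.stencil, |∑ a, (a.1.2.val : ℝ) *
      ((A.frame P ξ).u (P.pos i) / h) ^ a.1.1.val *
      ((A.frame P ξ).v (P.pos i) / h) ^ (a.1.2.val - 1) * d a -
      -(h * ⟪(A.frame P ξ).t, P.n i⟫ / ⟪(A.frame P ξ).m, P.n i⟫)| ≤ ρ)
    (a : MonoIdx p) : |A.coeff a - d a| ≤ Fintype.card (MonoIdx p) * κ * ρ := by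
  refine hA.2.abs_sub_le hc hρ ?_ ?_ a
  · rintro (i | i | i)
    · exact hd i i.2
    · exact hdu i i.2
    · exact hdv i i.2
  · have h1 : 1 < p + 1 := by omega
    rintro (i | i | i)
    · refine ⟨MonoIdx.zero p, ?_⟩
      change 1 ≤ |(A.frame P ξ).pointMatrix h p (A.stencilPos P) i (MonoIdx.zero p)|
      simp [LocalFrame.pointMatrix, MonoIdx.zero]
    · let b : MonoIdx p := ⟨(⟨1, h1⟩, 0), by simpa using hp⟩
      refine ⟨b, ?_⟩
      change 1 ≤ |(A.frame P ξ).derivMatrixU h p (A.stencilPos P) i b|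
      simp [LocalFrame.derivMatrixU, b]
    · let b : MonoIdx p := ⟨(0, ⟨1, h1⟩), by simpa using hp⟩
      refine ⟨b, ?_⟩
      change 1 ≤ |(A.frame P ξ).derivMatrixV h p (A.stencilPos P) i b|
      simp [LocalFrame.derivMatrixV, b]

/-- The point is a CMF or H-CMF reconstruction. -/
def LocalFit.IsReconstruction {p : ℕ} (A : LocalFit p N) (Γ : Set Space) (s : ℝ≥0∞)
    [Fact (1 ≤ s)] (h Cn κ : ℝ) (P : MeshPatch N) (y : Fin N → Space) (ξ : Plane) : Prop :=
  (A.IsCMF P ξ h ∧ WellConditioned s κ (A.cmfSystem P ξ h)) ∨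
  (A.IsHCMF P ξ h ∧ WellConditioned s κ (A.hcmfSystem P ξ h) ∧
    P.NormalsAccurateOn Γ p h Cn y A.stencil)

/-- The errors `1/4 + 1/8 + 1/8` place `v` within `1/2` of `m` or of `-m`. The sign is immaterial,
since Hermite data involve only ratios of components; the bound keeps their denominators away from
zero. -/
theorem half_le_abs_inner {m m₀ ν v : Space} (hm1 : ‖m‖ = 1) (hm : ‖m - m₀‖ ≤ 1 / 8)
    (hν : ‖ν - m₀‖ < 1 / 8 ∨ ‖ν + m₀‖ < 1 / 8) (hv : ‖v - ν‖ ≤ 1 / 4) : 1 / 2 ≤ |⟪m, v⟫| := by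
  have key : ∀ r : Space, ‖r‖ ≤ 1 / 2 → |⟪m, r⟫| ≤ 1 / 2 := fun r hr => by
    have := abs_real_inner_le_norm m r
    rw [hm1, one_mul] at this
    exact this.trans hr
  have hmm : ⟪m, m⟫ = (1 : ℝ) := by rw [real_inner_self_eq_norm_sq, hm1, one_pow]
  rcases hν with hν | hν
  · have h1 : ‖v - m‖ ≤ 1 / 2 := by
      have e : v - m = (v - ν) + ((ν - m₀) - (m - m₀)) := by abel
      rw [e]
      have := norm_add_le (v - ν) ((ν - m₀) - (m - m₀))
      have := norm_sub_le (ν - m₀) (m - m₀)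
      linarith
    have h2 := abs_le.1 (key _ h1)
    rw [inner_sub_right, hmm] at h2
    have := le_abs_self ⟪m, v⟫
    linarith [h2.1]
  · have h1 : ‖v + m‖ ≤ 1 / 2 := by
      have e : v + m = (v - ν) + ((ν + m₀) + (m - m₀)) := by abel
      rw [e]
      have := norm_add_le (v - ν) ((ν + m₀) + (m - m₀))
      have := norm_add_le (ν + m₀) (m - m₀)
      linarith
    have h2 := abs_le.1 (key _ h1)
    rw [inner_add_right, hmm] at h2
    have := neg_abs_le ⟪m, v⟫
    linarith [h2.2]

theorem exists_small_of_pos {K a : ℝ} (hK : 0 ≤ K) (ha : 0 < a) :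
    ∃ t₀ > 0, ∀ t, t ≤ t₀ → K * t < a := by
  obtain ⟨c, hc, h⟩ := exists_pos_mul_lt ha K
  exact ⟨c, hc, fun t ht => (mul_le_mul_of_nonneg_left ht hK).trans_lt h⟩

/-- Reconstructed points are accurate, if the moving frame is close to a given direction. -/
theorem IsGraphChart.exists_projection_bound {Γ : Set Space} {F : Space → ℝ} {y₀ m₀ : Space}
    {ρ L η L' δ R Cx Cn κ : ℝ} {ψ : ChartParam → ℝ} (hψ : IsGraphChart (n + 2) F y₀ m₀ ρ ψ η L')
    (h : IsLocalEquation Γ (n + 2) F y₀ ρ L) (hδ : 0 < δ)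
    (hnormal : ∀ y ∈ Γ, dist y y₀ < δ → ∀ ν, IsUnitNormal Γ y ν →
      ‖ν - m₀‖ < 1 / 8 ∨ ‖ν + m₀‖ < 1 / 8)
    (hR : 0 ≤ R) (hCx : 0 ≤ Cx) (hCn : 0 ≤ Cn) (hκ : 0 ≤ κ) (s : ℝ≥0∞) [Fact (1 ≤ s)] :
    ∃ C t₀ : ℝ, 0 ≤ C ∧ 0 < t₀ ∧ ∀ t, 0 < t → t ≤ t₀ → ∀ (N : ℕ) (P : MeshPatch N)
      (y : Fin N → Space) (ξ : Plane) (A : LocalFit (n + 1) N),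
      (∀ i, y i ∈ Γ ∧ ‖P.pos i - y i‖ ≤ Cx * t ^ (n + 2)) → A.IsLocal P t R →
      A.IsReconstruction Γ s t Cn κ P y ξ → dist (P.avgNormal ξ) m₀ < η →
      dist (P.avgNormal ξ) m₀ ≤ 1 / 8 → dist (y (P.tri 0)) y₀ < t₀ →
      (∃ z ∈ Γ, dist (A.projection P ξ) z ≤ C * t ^ (n + 2)) ∧
        dist (A.projection P ξ) (y (P.tri 0)) ≤ C * t := by
  have hη := hψ.radius_pos
  have hρ := h.radius_pos
  have hL := h.bound_pos
  have hL' := hψ.bound_pos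
  obtain ⟨t₁, ht₁, hsmall₁⟩ := exists_small_of_pos (K := 4 * (1 + R + Cx)) (by positivity)
    (lt_min hη (lt_min hρ hδ))
  obtain ⟨t₂, ht₂, hsmall₂⟩ := exists_small_of_pos (K := L * Cx) (by positivity) hη
  obtain ⟨t₃, ht₃, hsmall₃⟩ := exists_small_of_pos (K := Cn) hCn (by norm_num : (0 : ℝ) < 1 / 4)
  set t₀ := min 1 (min t₁ (min t₂ t₃))
  have ht₀ : 0 < t₀ := by positivity
  have hle₁ : t₀ ≤ t₁ := (min_le_right _ _).trans (min_le_left _ _)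
  have hle₂ : t₀ ≤ t₂ := (min_le_right _ _).trans ((min_le_right _ _).trans (min_le_left _ _))
  have hle₃ : t₀ ≤ t₃ := (min_le_right _ _).trans ((min_le_right _ _).trans (min_le_right _ _))
  set C₁ := L' * L * Cx + L' * (2 * R) ^ (n + 2)
  set C₂ := 2 * ((1 + L') * (Cn + L ^ 2 * (L' * L * Cx + Cx))) + L' * (2 * R) ^ (n + 1)
  have hC₁ : 0 ≤ C₁ := by positivity
  have hC₂ : 0 ≤ C₂ := by positivity
  set C₀ := Fintype.card (MonoIdx (n + 1)) * κ * (C₁ + C₂)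
  have hC₀ : 0 ≤ C₀ := by positivity
  refine ⟨C₀ + (1 + L') * (R + Cx), t₀, by positivity, ht₀, ?_⟩
  intro t ht htt N P y ξ A hP hloc hrec hm hm8 hy₀
  have ht1 : t ≤ 1 := htt.trans (min_le_left _ _)
  have hpow : t ^ (n + 2) ≤ t := by
    simpa using pow_le_pow_of_le_one ht.le ht1 (show 1 ≤ n + 2 by omega)
  have hpow' : t ^ (n + 1) ≤ t := by
    simpa using pow_le_pow_of_le_one ht.le ht1 (show 1 ≤ n + 1 by omega)
  have hCxt : Cx * t ^ (n + 2) ≤ Cx * t := mul_le_mul_of_nonneg_left hpow hCx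
  set Q := A.frame P ξ
  have hQ : Q.IsOrthonormal := by
    rcases hrec with hrec | hrec
    · exact hrec.1.1
    · exact hrec.1.1
  have hQm : Q.m = P.avgNormal ξ := rfl
  have hQo : Q.origin = A.base := rfl
  have hby : dist A.base (y (P.tri 0)) ≤ (R + Cx) * t := by
    have h1 := dist_triangle A.base (P.pos (P.tri 0)) (y (P.tri 0))
    rw [dist_comm A.base (P.pos _), dist_eq_norm (P.pos _), dist_eq_norm (P.pos _)] at h1
    have h2 := hloc.2 0
    have h3 := (hP (P.tri 0)).2
    linarith
  -- The base lies within `(R + Cx) * t` of `y (P.tri 0)`, which lies within `t₀` of `y₀`.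
  set σ := (1 + R + Cx) * t₀
  have hσ4 : 4 * σ < min η (min ρ δ) := by
    have := hsmall₁ t₀ hle₁
    rwa [mul_assoc] at this
  have hση : 4 * σ < η := hσ4.trans_le (min_le_left _ _)
  have hσρ : 4 * σ < ρ := hσ4.trans_le ((min_le_right _ _).trans (min_le_left _ _))
  have hσδ : 4 * σ < δ := hσ4.trans_le ((min_le_right _ _).trans (min_le_right _ _))
  have hRt : R * t ≤ σ := by
    calc R * t ≤ R * t₀ := by gcongr
      _ ≤ _ := by simp only [σ]; gcongr; linarith
  have hCxσ : Cx * t ≤ σ := by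
    calc Cx * t ≤ Cx * t₀ := by gcongr
      _ ≤ _ := by simp only [σ]; gcongr; linarith
  have hb : dist A.base y₀ ≤ σ := by
    have h1 := dist_triangle A.base (y (P.tri 0)) y₀
    have h2 : (R + Cx) * t ≤ (R + Cx) * t₀ := by gcongr
    have h3 : σ = (R + Cx) * t₀ + t₀ := by ring
    linarith
  have hσ0 : 0 ≤ σ := dist_nonneg.trans hb
  obtain ⟨d, hd0, hd⟩ := hψ.exists_competitor h hQ (Cn := Cn) ht ht1 hm hCx hb hRt
    (hCxt.trans hCxσ) (by
      have := hsmall₂ t (htt.trans hle₂)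
      refine lt_of_le_of_lt ?_ this
      rw [mul_assoc]
      exact mul_le_mul_of_nonneg_left hCxt hL.le) hση hσρ
  have hval := fun i (hi : i ∈ A.stencil) =>
    hd (P.pos i) (y i) (hP i).1 (hloc.1 i hi) (hP i).2
  have ht2 : 0 ≤ t ^ (n + 2) := by positivity
  have hle1 : C₁ * t ^ (n + 2) ≤ (C₁ + C₂) * t ^ (n + 2) := by gcongr; linarith
  have hle2 : C₂ * t ^ (n + 2) ≤ (C₁ + C₂) * t ^ (n + 2) := by gcongr; linarith
  have hcoeff : |A.coeff (MonoIdx.zero (n + 1)) - ψ (A.base, P.avgNormal ξ, 0)| ≤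
      C₀ * t ^ (n + 2) := by
    have hfin : |A.coeff (MonoIdx.zero (n + 1)) - d (MonoIdx.zero (n + 1))| ≤
        Fintype.card (MonoIdx (n + 1)) * κ * ((C₁ + C₂) * t ^ (n + 2)) := by
      rcases hrec with ⟨hA, hcond⟩ | ⟨hA, hcond, hnor⟩
      · exact hA.abs_coeff_sub_le hcond (by positivity)
          (fun i hi => (hval i hi).1.trans hle1) _
      · have hder : ∀ i ∈ A.stencil, ∃ ν, IsUnitNormal Γ (y i) ν ∧
            ‖P.n i - ν‖ ≤ Cn * t ^ (n + 1) ∧ 1 / 2 ≤ |⟪Q.m, P.n i⟫| := by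
          intro i hi
          obtain ⟨ν, hν, hνn⟩ := hnor i hi
          refine ⟨ν, hν, hνn, half_le_abs_inner hQ.norm_m
            (by rw [← dist_eq_norm]; exact hm8) (hnormal (y i) (hP i).1 ?_ ν hν) (hνn.trans ?_)⟩
          · have h1 := dist_triangle4 (y i) (P.pos i) A.base y₀
            rw [dist_comm (y i) (P.pos i), dist_eq_norm (P.pos i) (y i), dist_eq_norm (P.pos i) A.base] at h1
            have h2 := (hP i).2
            have h3 := hloc.1 i hi
            linarith
          · have := hsmall₃ t (htt.trans hle₃)
            exact (mul_le_mul_of_nonneg_left hpow' hCn).trans this.le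
        refine hA.abs_coeff_sub_le (by omega) hcond (by positivity)
          (fun i hi => (hval i hi).1.trans hle1) (fun i hi => ?_) (fun i hi => ?_) _
        · obtain ⟨ν, h1, h2, h3⟩ := hder i hi
          exact ((hval i hi).2 ν _ h1 h2 h3).1.trans hle2
        · obtain ⟨ν, h1, h2, h3⟩ := hder i hi
          exact ((hval i hi).2 ν _ h1 h2 h3).2.trans hle2
    rw [hd0] at hfin
    refine hfin.trans (le_of_eq ?_)
    simp only [C₀]
    ring
  have hmem : ((A.base, P.avgNormal ξ, 0) : ChartParam) ∈ Metric.ball (y₀, m₀, (0 : ℝ)) η :=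
    mem_ball_chartParam.2 ⟨by linarith, hm, by simpa using hη⟩
  -- The point of `Γ` over the base; its height is the constant coefficient of the competitor.
  set z := A.base + ψ (A.base, P.avgNormal ξ, 0) • P.avgNormal ξ
  have hzΓ : z ∈ Γ := by
    rw [h.mem_iff z (hψ.mem_ball (A.base, P.avgNormal ξ, 0) hmem)]
    exact hψ.apply_eq (A.base, P.avgNormal ξ, 0) hmem
  have hxz : dist (A.projection P ξ) z ≤ C₀ * t ^ (n + 2) := by
    refine le_of_eq_of_le ?_ hcoeff
    rw [LocalFit.projection, dist_add_left, dist_eq_norm, ← sub_smul, norm_smul,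
      show ‖P.avgNormal ξ‖ = 1 from hQ.norm_m, mul_one, Real.norm_eq_abs]
  -- Over the surface point `y (P.tri 0)` the height is 0, so the Lipschitz bound in the base point
  -- controls the height here. This yields the `O(t)` localization that later keeps the element in
  -- one chart.
  have hzb : dist z A.base ≤ L' * ((R + Cx) * t) := by
    have hF0 : F (y (P.tri 0)) = 0 := by
      rw [← h.mem_iff]
      · exact (hP _).1
      · rw [Metric.mem_ball]
        have : t₀ ≤ σ := by
          have : 0 ≤ (R + Cx) * t₀ := by positivity
          have h3 : σ = (R + Cx) * t₀ + t₀ := by ring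
          linarith
        linarith
    have hy₀η : dist (y (P.tri 0)) y₀ < η := by
      have : t₀ ≤ σ := by
        have : 0 ≤ (R + Cx) * t₀ := by positivity
        have h3 : σ = (R + Cx) * t₀ + t₀ := by ring
        linarith
      linarith
    have h1 := hψ.unique (y (P.tri 0)) (P.avgNormal ξ) 0 hy₀η hm (by simpa using hη)
      (by simpa [hF0] using hη)
    rw [zero_smul, add_zero, hF0] at h1
    have h2 := hψ.lipschitz (A.base, P.avgNormal ξ, 0) hmem (y (P.tri 0), P.avgNormal ξ, 0)
      (mem_ball_chartParam.2 ⟨hy₀η, hm, by simpa using hη⟩)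
    rw [h1, sub_zero] at h2
    have e : dist z A.base = |ψ (A.base, P.avgNormal ξ, 0)| := by
      rw [dist_eq_norm, add_sub_cancel_left, norm_smul,
        show ‖P.avgNormal ξ‖ = 1 from hQ.norm_m, mul_one, Real.norm_eq_abs]
    rw [e]
    refine h2.trans (mul_le_mul_of_nonneg_left ?_ hL'.le)
    simpa [Prod.dist_eq] using hby
  have hextra : 0 ≤ (1 + L') * (R + Cx) := by positivity
  refine ⟨⟨z, hzΓ, hxz.trans ?_⟩, ?_⟩
  · gcongr
    linarith
  · have h1 := dist_triangle4 (A.projection P ξ) z A.base (y (P.tri 0))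
    have h2 : C₀ * t ^ (n + 2) ≤ C₀ * t := by gcongr
    calc _ ≤ C₀ * t + L' * ((R + Cx) * t) + (R + Cx) * t := by linarith
      _ = _ := by ring

end FitAccuracy

/-! ### Orientation and averaging of the frame normals -/

section MovingFrames

theorem baryCoord_nonneg {ξ : Plane} (hξ : ξ ∈ refTriangle) (j : Fin 3) : 0 ≤ baryCoord ξ j := by
  obtain ⟨h0, h1, h2⟩ := hξ
  fin_cases j
  · simp [baryCoord]; linarith
  · simpa [baryCoord] using h0
  · simpa [baryCoord] using h1

theorem sum_baryCoord (ξ : Plane) : ∑ j, baryCoord ξ j = 1 := by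
  simp only [baryCoord, Fin.sum_univ_three, Matrix.cons_val]
  ring

/-- A convex combination of the corner normals stays within `η` of `m₀`, so its norm differs from 1
by at most `η`, and normalizing moves it by at most `η` more. -/
theorem MeshPatch.dist_avgNormal_le {N : ℕ} {P : MeshPatch N} {ξ : Plane} (hξ : ξ ∈ refTriangle)
    {m₀ : Space} {η : ℝ} (hm₀ : ‖m₀‖ = 1) (hη : η < 1) (h : ∀ j, ‖P.m (P.tri j) - m₀‖ ≤ η) :
    dist (P.avgNormal ξ) m₀ ≤ 2 * η := by
  set V := ∑ j, baryCoord ξ j • P.m (P.tri j)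
  have hV : ‖V - m₀‖ ≤ η := by
    have e : V - m₀ = ∑ j, baryCoord ξ j • (P.m (P.tri j) - m₀) := by
      simp only [smul_sub, Finset.sum_sub_distrib, ← Finset.sum_smul, sum_baryCoord, one_smul, V]
    rw [e]
    refine (norm_sum_le _ _).trans ?_
    calc _ ≤ ∑ j, baryCoord ξ j * η := by
          refine Finset.sum_le_sum fun j _ => ?_
          rw [norm_smul, Real.norm_of_nonneg (baryCoord_nonneg hξ j)]
          exact mul_le_mul_of_nonneg_left (h j) (baryCoord_nonneg hξ j)
      _ = η := by rw [← Finset.sum_mul, sum_baryCoord, one_mul]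
  have habs : |‖V‖ - 1| ≤ η := by
    rw [← hm₀]
    exact (abs_norm_sub_norm_le V m₀).trans hV
  have hpos : 0 < ‖V‖ := by linarith [(abs_le.1 habs).1]
  have hd : ‖‖V‖⁻¹ • V - V‖ ≤ η := by
    have e : ‖V‖⁻¹ • V - V = (‖V‖⁻¹ - 1) • V := by rw [sub_smul, one_smul]
    rw [e, norm_smul, Real.norm_eq_abs, ← abs_of_pos hpos, ← abs_mul, abs_of_pos hpos, sub_mul,
      inv_mul_cancel₀ hpos.ne', one_mul, abs_sub_comm]
    exact habs
  calc dist (P.avgNormal ξ) m₀ ≤ dist (‖V‖⁻¹ • V) V + dist V m₀ := dist_triangle _ _ _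
    _ ≤ 2 * η := by rw [dist_eq_norm, dist_eq_norm]; linarith

/-- Vectors near opposite directions have inner product at most `-1 + 2 * η + η ^ 2`, which is
negative for `η ≤ 1 / 4`. -/
theorem forall_near_or_forall_near_neg {ι : Type} {m : ι → Space} {n₀ : Space} {η : ℝ}
    (hn₀ : ‖n₀‖ = 1) (hη : η ≤ 1 / 4) (h : ∀ j, ‖m j - n₀‖ ≤ η ∨ ‖m j + n₀‖ ≤ η)
    (hpos : ∀ j k, 0 < ⟪m j, m k⟫) :
    (∀ j, ‖m j - n₀‖ ≤ η) ∨ ∀ j, ‖m j + n₀‖ ≤ η := by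
  by_contra! hcon
  obtain ⟨⟨j, hj⟩, k, hk⟩ := hcon
  have hj' := (h j).resolve_left (not_le.2 hj)
  have hk' := (h k).resolve_right (not_le.2 hk)
  have h0 := (norm_nonneg _).trans hj'
  have h1 : ⟪m j + n₀, m k - n₀⟫ ≤ η * η :=
    (real_inner_le_norm _ _).trans (mul_le_mul hj' hk' (norm_nonneg _) h0)
  have h2 : ⟪m j + n₀, n₀⟫ ≤ η := by
    have := real_inner_le_norm (m j + n₀) n₀
    rw [hn₀, mul_one] at this
    exact this.trans hj'
  have h3 : -η ≤ ⟪n₀, m k - n₀⟫ := by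
    have := abs_real_inner_le_norm n₀ (m k - n₀)
    rw [hn₀, one_mul] at this
    exact (abs_le.1 (this.trans hk')).1
  have hnn : ⟪n₀, n₀⟫ = (1 : ℝ) := by rw [real_inner_self_eq_norm_sq, hn₀, one_pow]
  rw [inner_sub_right, inner_add_left, inner_add_left, hnn] at h1
  rw [inner_add_left, hnn] at h2
  rw [inner_sub_right, hnn] at h3
  have := hpos j k
  nlinarith

/-- Accuracy of the reconstructions for triangles close to a point of the surface. -/
theorem exists_fit_bound_near {n : ℕ} {Γ K : Set Space} (hΓ : IsSurfaceOfClass (n + 2) Γ)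
    (hKΓ : K ⊆ Γ) {y₀ : Space} (hy₀ : y₀ ∈ Γ) {R Cx Cm Cn κ : ℝ} (hR : 0 ≤ R) (hCx : 0 ≤ Cx)
    (hCm : 0 ≤ Cm) (hCn : 0 ≤ Cn) (hκ : 0 ≤ κ) (s : ℝ≥0∞) [Fact (1 ≤ s)] :
    ∃ C t₀ : ℝ, 0 < t₀ ∧ ∀ t, 0 < t → t ≤ t₀ → ∀ (N : ℕ) (P : MeshPatch N)
      (y : Fin N → Space) (ξ : Plane) (A : LocalFit (n + 1) N),
      P.IsAccurate Γ K (n + 1) t Cx Cm y → ξ ∈ refTriangle → A.IsLocal P t R →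
      A.IsReconstruction Γ s t Cn κ P y ξ → dist (y (P.tri 0)) y₀ < t₀ →
      (∃ z ∈ Γ, dist (A.projection P ξ) z ≤ C * t ^ (n + 2)) ∧
        dist (A.projection P ξ) (y (P.tri 0)) ≤ C * t := by
  obtain ⟨F, ρ, L, hF⟩ := IsSurfaceOfClass.exists_isLocalEquation (p := n + 1) (by omega) hΓ hy₀
  obtain ⟨n₀, hn₀, hFn₀, hnear⟩ := hF.exists_normal (by omega)
  -- One chart for each common orientation of the corner normals.
  obtain ⟨ψ₁, η₁, L₁, hψ₁⟩ := hF.exists_isGraphChart (by omega) hy₀ hFn₀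
  obtain ⟨ψ₂, η₂, L₂, hψ₂⟩ := hF.exists_isGraphChart (m₀ := -n₀) (by omega) hy₀
    (by rwa [map_neg, neg_ne_zero])
  have hη₁ := hψ₁.radius_pos
  have hη₂ := hψ₂.radius_pos
  obtain ⟨δ, hδ, hδn⟩ := hnear (1 / 8) (by norm_num)
  obtain ⟨C₁, t₁, hC₁, ht₁, hfit₁⟩ := hψ₁.exists_projection_bound hF hδ hδn hR hCx hCn hκ s
  obtain ⟨C₂, t₂, hC₂, ht₂, hfit₂⟩ := hψ₂.exists_projection_bound hF hδ
    (fun y hy hd ν hν => by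
      rw [sub_neg_eq_add, ← sub_eq_add_neg]
      exact (hδn y hy hd ν hν).symm) hR hCx hCn hκ s
  -- Averaging doubles the error, and `2 * η` must be at most `1 / 8` and below both chart radii.
  set η := min (1 / 16) (min (η₁ / 4) (η₂ / 4))
  have hη : 0 < η := by positivity
  have hη16 : η ≤ 1 / 16 := min_le_left _ _
  have hηη₁ : η ≤ η₁ / 4 := (min_le_right _ _).trans (min_le_left _ _)
  have hηη₂ : η ≤ η₂ / 4 := (min_le_right _ _).trans (min_le_right _ _)
  obtain ⟨δ', hδ', hδn'⟩ := hnear (η / 2) (by positivity)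
  obtain ⟨t₃, ht₃, hsmall₃⟩ := exists_small_of_pos (K := Cm) hCm (half_pos hη)
  obtain ⟨t₄, ht₄, hsmall₄⟩ := exists_small_of_pos (K := 1 + 2 * R + 2 * Cx) (by positivity) hδ'
  set t₀ := min (min t₁ t₂) (min (min t₃ t₄) 1)
  have hle₁ : t₀ ≤ t₁ := (min_le_left _ _).trans (min_le_left _ _)
  have hle₂ : t₀ ≤ t₂ := (min_le_left _ _).trans (min_le_right _ _)
  have hle₃ : t₀ ≤ t₃ := (min_le_right _ _).trans ((min_le_left _ _).trans (min_le_left _ _))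
  have hle₄ : t₀ ≤ t₄ := (min_le_right _ _).trans ((min_le_left _ _).trans (min_le_right _ _))
  have hle1 : t₀ ≤ 1 := (min_le_right _ _).trans (min_le_right _ _)
  refine ⟨max C₁ C₂, t₀, by positivity, ?_⟩
  intro t ht htt N P y ξ A hacc hξ hloc hrec hyt
  have hP : ∀ i, y i ∈ Γ ∧ ‖P.pos i - y i‖ ≤ Cx * t ^ (n + 2) := fun i =>
    ⟨hKΓ (hacc.1 i).1, (hacc.1 i).2.1⟩
  have hpow : t ^ (n + 2) ≤ t := by
    simpa using pow_le_pow_of_le_one ht.le (htt.trans hle1) (show 1 ≤ n + 2 by omega)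
  have hCxt : Cx * t ^ (n + 2) ≤ Cx * t := mul_le_mul_of_nonneg_left hpow hCx
  have hm : ∀ j, ‖P.m (P.tri j) - n₀‖ ≤ η ∨ ‖P.m (P.tri j) + n₀‖ ≤ η := by
    intro j
    obtain ⟨ν, hν, hmν⟩ := (hacc.1 (P.tri j)).2.2.2
    have hd : dist (y (P.tri j)) y₀ < δ' := by
      have h1 := dist_triangle4 (y (P.tri j)) (P.pos (P.tri j)) A.base (P.pos (P.tri 0))
      have h2 := dist_triangle4 (y (P.tri j)) (P.pos (P.tri 0)) (y (P.tri 0)) y₀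
      have h3 := (hP (P.tri j)).2
      have h4 := (hP (P.tri 0)).2
      have h5 := hloc.2 j
      have h6 := hloc.2 0
      rw [← dist_eq_norm] at h3 h4 h5 h6
      rw [dist_comm] at h3
      rw [dist_comm A.base] at h1
      have h7 := hsmall₄ t₀ hle₄
      have h8 : (2 * R + 2 * Cx) * t ≤ (2 * R + 2 * Cx) * t₀ := by gcongr
      linarith
    have h1 := hsmall₃ t (htt.trans hle₃)
    rcases hδn' _ (hP (P.tri j)).1 hd ν hν with h2 | h2
    · left
      have := norm_sub_le_norm_sub_add_norm_sub (P.m (P.tri j)) ν n₀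
      linarith
    · right
      have e : P.m (P.tri j) + n₀ = (P.m (P.tri j) - ν) + (ν + n₀) := by abel
      have := norm_add_le (P.m (P.tri j) - ν) (ν + n₀)
      rw [← e] at this
      linarith
  have hpos2 : 0 ≤ t ^ (n + 2) := by positivity
  rcases forall_near_or_forall_near_neg hn₀ (by linarith) hm hacc.2 with h | h
  · have havg := MeshPatch.dist_avgNormal_le hξ hn₀ (by linarith) h
    obtain ⟨⟨z, hz, hdz⟩, hdy⟩ := hfit₁ t ht (htt.trans hle₁) N P y ξ A hP hloc hrec
      (by linarith) (by linarith) (hyt.trans_le hle₁)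
    exact ⟨⟨z, hz, hdz.trans (by gcongr; exact le_max_left _ _)⟩,
      hdy.trans (by gcongr; exact le_max_left _ _)⟩
  · have havg := MeshPatch.dist_avgNormal_le (m₀ := -n₀) (η := η) hξ (by rwa [norm_neg])
      (by linarith) (by simpa only [sub_neg_eq_add] using h)
    obtain ⟨⟨z, hz, hdz⟩, hdy⟩ := hfit₂ t ht (htt.trans hle₂) N P y ξ A hP hloc hrec
      (by linarith) (by linarith) (hyt.trans_le hle₂)
    exact ⟨⟨z, hz, hdz.trans (by gcongr; exact le_max_right _ _)⟩,
      hdy.trans (by gcongr; exact le_max_right _ _)⟩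

end MovingFrames

/-! ### From local to uniform constants -/

section Compactness

/-- A bound that holds near each point of a compact set, with a constant and a threshold that
depend on the point, holds uniformly. -/
theorem IsCompact.exists_uniform_bound {K : Set Space} (hK : IsCompact K)
    {Pr : Space → ℝ → ℝ → Prop}
    (hmono : ∀ y C C' t, 0 < t → C ≤ C' → Pr y C t → Pr y C' t)
    (hloc : ∀ y₀ ∈ K, ∃ C t₀ : ℝ, 0 < t₀ ∧ ∀ t, 0 < t → t ≤ t₀ → ∀ y ∈ K, dist y y₀ < t₀ →
      Pr y C t) :
    ∃ C t₀ : ℝ, 0 < t₀ ∧ ∀ t, 0 < t → t ≤ t₀ → ∀ y ∈ K, Pr y C t := by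
  refine hK.induction_on (p := fun S => ∃ C t₀ : ℝ, 0 < t₀ ∧ ∀ t, 0 < t → t ≤ t₀ → ∀ y ∈ S,
    Pr y C t) ⟨0, 1, one_pos, by simp⟩ ?_ ?_ ?_
  · rintro S S' hSS ⟨C, t₀, ht₀, h⟩
    exact ⟨C, t₀, ht₀, fun t ht htt y hy => h t ht htt y (hSS hy)⟩
  · rintro S S' ⟨C, t₀, ht₀, h⟩ ⟨C', t₀', ht₀', h'⟩
    refine ⟨max C C', min t₀ t₀', lt_min ht₀ ht₀', ?_⟩
    rintro t ht htt y (hy | hy)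
    · exact hmono y C _ t ht (le_max_left _ _) (h t ht (htt.trans (min_le_left _ _)) y hy)
    · exact hmono y C' _ t ht (le_max_right _ _) (h' t ht (htt.trans (min_le_right _ _)) y hy)
  · intro y₀ hy₀
    obtain ⟨C, t₀, ht₀, h⟩ := hloc y₀ hy₀
    exact ⟨K ∩ Metric.ball y₀ t₀, inter_mem_nhdsWithin K (Metric.ball_mem_nhds _ ht₀), C, t₀, ht₀,
      fun t ht htt y hy => h t ht htt y hy.1 hy.2⟩

end Compactness

/-! ### From accurate nodes to accurate elements -/

section ParametricElements

theorem contDiff_shapeEval (q : MvPolynomial (Fin 2) ℝ) {k : WithTop ℕ∞} :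
    ContDiff ℝ k (shapeEval q) := by
  unfold shapeEval
  simp only [MvPolynomial.eval_eq']
  fun_prop

theorem contDiff_elementMap {p : ℕ} (t : ℝ) (B : Fin (numNodes p) → MvPolynomial (Fin 2) ℝ)
    (x : Fin (numNodes p) → Space) {k : WithTop ℕ∞} : ContDiff ℝ k (elementMap t B x) := by
  unfold elementMap
  refine ContDiff.sum fun i _ => ?_
  have h : ContDiff ℝ k fun ζ => shapeEval (B i) (t⁻¹ • ζ) :=
    (contDiff_shapeEval (B i)).comp (contDiff_const_smul _)
  fun_prop

theorem elementMap_node {p : ℕ} {t : ℝ} (ht : t ≠ 0) {ξ : Fin (numNodes p) → Plane}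
    {B : Fin (numNodes p) → MvPolynomial (Fin 2) ℝ} (hB : IsLagrangeBasis p ξ B)
    (x : Fin (numNodes p) → Space) (i : Fin (numNodes p)) :
    elementMap t B x (t • ξ i) = x i := by
  simp [elementMap, smul_smul, inv_mul_cancel₀ ht, hB.2]

theorem norm_le_one_of_mem_refTriangle {ξ : Plane} (hξ : ξ ∈ refTriangle) : ‖ξ‖ ≤ 1 := by
  obtain ⟨h0, h1, h2⟩ := hξ
  rw [EuclideanSpace.norm_eq, Fin.sum_univ_two, Real.sqrt_le_one]
  simp only [Real.norm_eq_abs, sq_abs]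
  nlinarith

theorem smul_mem_refTriangle {ξ : Plane} (hξ : ξ ∈ refTriangle) {r : ℝ} (hr0 : 0 ≤ r)
    (hr1 : r ≤ 1) : r • ξ ∈ refTriangle := by
  obtain ⟨h0, h1, h2⟩ := hξ
  refine ⟨mul_nonneg hr0 h0, mul_nonneg hr0 h1, ?_⟩
  change r * ξ 0 + r * ξ 1 ≤ 1
  nlinarith

theorem convex_refTriangle : Convex ℝ refTriangle := by
  intro ξ hξ ζ hζ a b ha hb hab
  obtain ⟨h0, h1, h2⟩ := hξ
  obtain ⟨k0, k1, k2⟩ := hζ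
  refine ⟨add_nonneg (mul_nonneg ha h0) (mul_nonneg hb k0),
    add_nonneg (mul_nonneg ha h1) (mul_nonneg hb k1), ?_⟩
  change a * ξ 0 + b * ζ 0 + (a * ξ 1 + b * ζ 1) ≤ 1
  nlinarith

-- The mean value inequality on a convex triangle of size `t`: the whole element lies within `O(t)`
-- of any of its nodes, hence in a single chart.
open scoped Pointwise in
theorem IsSmoothToDegree.dist_le {q : ℕ} (hq : 1 ≤ q) {t M : ℝ} (ht : 0 ≤ t) {f : Plane → Space}
    (hf : Differentiable ℝ f) (h : IsSmoothToDegree q t M f) {ξ ζ : Plane}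
    (hξ : ξ ∈ refTriangle) (hζ : ζ ∈ refTriangle) :
    dist (f (t • ζ)) (f (t • ξ)) ≤ 2 * M * t := by
  have hbound : ∀ z ∈ t • refTriangle, ‖fderiv ℝ f z‖ ≤ M := by
    rintro _ ⟨η, hη, rfl⟩
    have := h 1 le_rfl hq η hη
    rwa [norm_iteratedFDeriv_one] at this
  have hM : 0 ≤ M := (norm_nonneg _).trans (hbound (t • ξ) ⟨ξ, hξ, rfl⟩)
  have h1 := (convex_refTriangle.smul t).norm_image_sub_le_of_norm_fderiv_le
    (fun z _ => hf z) hbound (⟨ξ, hξ, rfl⟩ : t • ξ ∈ t • refTriangle) ⟨ζ, hζ, rfl⟩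
  rw [dist_eq_norm]
  refine h1.trans ?_
  change M * ‖t • ζ - t • ξ‖ ≤ _
  rw [← smul_sub, norm_smul, Real.norm_of_nonneg ht]
  have h2 : ‖ζ - ξ‖ ≤ 2 := by
    have := norm_sub_le ζ ξ
    have := norm_le_one_of_mem_refTriangle hξ
    have := norm_le_one_of_mem_refTriangle hζ
    linarith
  calc M * (t * ‖ζ - ξ‖) ≤ M * (t * 2) := by gcongr
    _ = _ := by ring

/-- The Faà di Bruno estimate, localized to open sets because the equation `g` is smooth only on
`U`. -/
theorem norm_iteratedFDeriv_comp_le_of_isOpen {E G : Type} [NormedAddCommGroup E]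
    [NormedSpace ℝ E] [NormedAddCommGroup G] [NormedSpace ℝ G] {g : E → ℝ} {f : G → E} {n : ℕ}
    {U : Set E} (hU : IsOpen U) (hg : ∀ z ∈ U, ContDiffAt ℝ n g z) (hf : ContDiff ℝ n f) {x : G}
    (hx : f x ∈ U) {C D : ℝ} (hC : ∀ i ≤ n, ‖iteratedFDeriv ℝ i g (f x)‖ ≤ C)
    (hD : ∀ i, 1 ≤ i → i ≤ n → ‖iteratedFDeriv ℝ i f x‖ ≤ D ^ i) :
    ‖iteratedFDeriv ℝ n (g ∘ f) x‖ ≤ n.factorial * C * D ^ n := by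
  have hV : IsOpen (f ⁻¹' U) := hU.preimage hf.continuous
  have h := norm_iteratedFDerivWithin_comp_le (𝕜 := ℝ) (g := g) (f := f) (n := n) (s := f ⁻¹' U)
    (t := U) (x := x) (N := n) (fun z hz => (hg z hz).contDiffWithinAt) hf.contDiffOn le_rfl
    hU.uniqueDiffOn hV.uniqueDiffOn (Set.mapsTo_preimage f U) hx
    (fun i hi => by rw [iteratedFDerivWithin_of_isOpen i hU hx]; exact hC i hi)
    (fun i h1 hi => by rw [iteratedFDerivWithin_of_isOpen i hV hx]; exact hD i h1 hi)
  rwa [iteratedFDerivWithin_of_isOpen n hV hx] at h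

/-- Stable polynomial interpolation controls a smooth function by its nodal values. -/
theorem abs_le_of_nodal_bound {p : ℕ} {ξ : Fin (numNodes p) → Plane}
    {B : Fin (numNodes p) → MvPolynomial (Fin 2) ℝ} (hB : IsLagrangeBasis p ξ B)
    (hξ : ∀ i, ξ i ∈ refTriangle) {Λ : ℝ} (hΛ : IsStable p B Λ) {g : Plane → ℝ} {t M ε : ℝ}
    (ht : 0 ≤ t) (hM : 0 ≤ M) (hε : 0 ≤ ε)
    (hg : ∀ ζ ∈ refTriangle, ContDiffAt ℝ (p + 1 : ℕ) g (t • ζ))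
    (hgM : ∀ ζ ∈ refTriangle, ‖iteratedFDeriv ℝ (p + 1) g (t • ζ)‖ ≤ M)
    (hgε : ∀ i, |g (t • ξ i)| ≤ ε) {ζ : Plane} (hζ : ζ ∈ refTriangle) :
    |g (t • ζ)| ≤ Λ * (ε + M * t ^ (p + 1)) + M * t ^ (p + 1) := by
  -- The expansion is at the vertex 0, from which the triangle is star-shaped and at distance at
  -- most `t`.
  have hT : ∀ ζ ∈ refTriangle,
      |g (t • ζ) - taylorSum p g 0 (t • ζ)| ≤ M * t ^ (p + 1) := by
    intro ζ hζ
    have hseg : ∀ q ∈ segment ℝ 0 (t • ζ), ∃ η ∈ refTriangle, 0 + q = t • η := by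
      intro q hq
      obtain ⟨r, hr, rfl⟩ := (segment_eq_image ℝ (0 : Plane) (t • ζ) ▸ hq)
      exact ⟨r • ζ, smul_mem_refTriangle hζ hr.1 hr.2, by
        dsimp only
        rw [smul_zero, zero_add, zero_add, smul_comm]⟩
    have h1 := norm_sub_taylorSum_le p (f := g) (a := 0) (x := t • ζ) (M := M)
      (fun q hq => by
        obtain ⟨η, hη, he⟩ := hseg q hq
        rw [he]; exact hg η hη)
      (fun q hq => by
        obtain ⟨η, hη, he⟩ := hseg q hq
        rw [he]; exact hgM η hη)
    rw [zero_add, Real.norm_eq_abs] at h1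
    refine h1.trans ?_
    have h2 : ‖t • ζ‖ ≤ t := by
      rw [norm_smul, Real.norm_of_nonneg ht]
      exact mul_le_of_le_one_right ht (norm_le_one_of_mem_refTriangle hζ)
    gcongr
  set τ := M * t ^ (p + 1)
  have hrep : ∀ η : Plane, taylorSum p g 0 (t • η) = taylorSum p g 0
      (η 0 • t • EuclideanSpace.single 0 1 + η 1 • t • EuclideanSpace.single 1 1) := by
    intro η
    congr 1
    ext k
    fin_cases k <;> simp [mul_comm]
  have hsum := hB.eq_sum (taylorSum_mem_bivariatePoly p g 0 (t • EuclideanSpace.single 0 1)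
    (t • EuclideanSpace.single 1 1)) ζ
  rw [← hrep ζ] at hsum
  have hnode : ∀ i, |taylorSum p g 0 (t • ξ i)| ≤ ε + τ := by
    intro i
    have h1 := hT (ξ i) (hξ i)
    have h2 := hgε i
    rw [abs_le] at *
    constructor <;> linarith
  have hτ : 0 ≤ τ := by positivity
  -- The Taylor polynomial equals its own interpolant, so stability bounds it by its nodal values.
  have hTζ : |taylorSum p g 0 (t • ζ)| ≤ Λ * (ε + τ) := by
    rw [hsum]
    refine (Finset.abs_sum_le_sum_abs _ _).trans ?_
    calc _ ≤ ∑ i, |shapeEval (B i) ζ| * (ε + τ) := by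
          refine Finset.sum_le_sum fun i _ => ?_
          rw [abs_mul]
          refine mul_le_mul_of_nonneg_left ?_ (abs_nonneg _)
          rw [← hrep (ξ i)]
          exact hnode i
      _ ≤ Λ * (ε + τ) := by
          rw [← Finset.sum_mul]
          exact mul_le_mul_of_nonneg_right (hΛ ζ hζ) (by positivity)
  have h3 := hT ζ hζ
  have h4 := abs_sub_abs_le_abs_sub (g (t • ζ)) (taylorSum p g 0 (t • ζ))
  linarith

/-- Accuracy of an element with accurate nodes, close to a point of the surface. -/
theorem exists_element_bound_near {p : ℕ} (hp : 1 ≤ p) {Γ : Set Space}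
    (hΓ : IsSurfaceOfClass (p + 1) Γ) {y₀ : Space} (hy₀ : y₀ ∈ Γ) {Cₙ Λ M : ℝ} (hCₙ : 0 ≤ Cₙ)
    (hΛ : 0 ≤ Λ) (hM : 0 ≤ M) :
    ∃ C t₀ : ℝ, 0 < t₀ ∧ ∀ t, 0 < t → t ≤ t₀ → ∀ (ξ : Fin (numNodes p) → Plane)
      (B : Fin (numNodes p) → MvPolynomial (Fin 2) ℝ) (x : Fin (numNodes p) → Space)
      (i₀ : Fin (numNodes p)) (k : Space), (∀ i, ξ i ∈ refTriangle) → IsLagrangeBasis p ξ B →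
      IsStable p B Λ → (∀ i, ∃ z ∈ Γ, dist (x i) z ≤ Cₙ * t ^ (p + 1)) →
      IsSmoothToDegree (p + 1) t M (elementMap t B x) → dist (x i₀) k ≤ Cₙ * t →
      dist k y₀ < t₀ →
      ∀ ζ ∈ refTriangle, ∃ z ∈ Γ, dist (elementMap t B x (t • ζ)) z ≤ C * t ^ (p + 1) := by
  obtain ⟨F, ρ, L, hF⟩ := hΓ.exists_isLocalEquation hp hy₀
  obtain ⟨m₀, hm₀, hFm₀, -⟩ := hF.exists_normal (by omega)
  obtain ⟨ψ, η, L', hψ⟩ := hF.exists_isGraphChart (by omega) hy₀ hFm₀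
  have hη := hψ.radius_pos
  have hρ := hF.radius_pos
  have hL := hF.bound_pos
  have hL' := hψ.bound_pos
  -- With `1 ≤ D`, the bound `M` implies the bounds `D ^ i`, `i ≥ 1`, that the composition estimate
  -- needs.
  set D := max M 1
  have hD1 : 1 ≤ D := le_max_right _ _
  set M' := ((p + 1).factorial : ℝ) * L * D ^ (p + 1)
  have hM' : 0 ≤ M' := by positivity
  set C₂ := Λ * (L * Cₙ + M') + M'
  have hC₂ : 0 ≤ C₂ := by positivity
  obtain ⟨t₁, ht₁, hsmall₁⟩ := exists_small_of_pos (K := 2 * M + 2 * Cₙ + 1) (by positivity)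
    (lt_min hρ hη)
  obtain ⟨t₂, ht₂, hsmall₂⟩ := exists_small_of_pos hC₂ hη
  set t₀ := min 1 (min t₁ t₂)
  have hle1 : t₀ ≤ 1 := min_le_left _ _
  have hle₁ : t₀ ≤ t₁ := (min_le_right _ _).trans (min_le_left _ _)
  have hle₂ : t₀ ≤ t₂ := (min_le_right _ _).trans (min_le_right _ _)
  refine ⟨L' * C₂, t₀, by positivity, ?_⟩
  intro t ht htt ξ B x i₀ k hξ hB hBΛ hx hsmooth hk hky ζ hζ
  set X := elementMap t B x
  have hX : ∀ {q : WithTop ℕ∞}, ContDiff ℝ q X := contDiff_elementMap t B x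
  have hnode : ∀ i, X (t • ξ i) = x i := elementMap_node ht.ne' hB x
  have hpow : t ^ (p + 1) ≤ t := by
    simpa using pow_le_pow_of_le_one ht.le (htt.trans hle1) (show 1 ≤ p + 1 by omega)
  have hCt : Cₙ * t ≤ Cₙ * t₀ := by gcongr
  have hnear : ∀ ζ ∈ refTriangle, dist (X (t • ζ)) y₀ ≤ (2 * M + Cₙ + 1) * t₀ := by
    intro ζ hζ
    have h1 := hsmooth.dist_le (by omega) ht.le (hX.differentiable one_ne_zero) (hξ i₀) hζ
    rw [hnode] at h1
    have h2 := dist_triangle4 (X (t • ζ)) (x i₀) k y₀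
    have h3 : 2 * M * t ≤ 2 * M * t₀ := by gcongr
    linarith
  have hsmall := hsmall₁ t₀ hle₁
  have ht₀ : 0 < t₀ := ht.trans_le htt
  have hCt₀ : 0 ≤ Cₙ * t₀ := by positivity
  have hsmallρ : (2 * M + 2 * Cₙ + 1) * t₀ < ρ := hsmall.trans_le (min_le_left _ _)
  have hsmallη : (2 * M + 2 * Cₙ + 1) * t₀ < η := hsmall.trans_le (min_le_right _ _)
  have hball : ∀ ζ ∈ refTriangle, X (t • ζ) ∈ Metric.ball y₀ ρ := by
    intro ζ hζ
    have := hnear ζ hζ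
    rw [Metric.mem_ball]
    linarith
  have hFnode : ∀ i, |(F ∘ X) (t • ξ i)| ≤ L * Cₙ * t ^ (p + 1) := by
    intro i
    obtain ⟨z, hz, hdz⟩ := hx i
    have hzρ : z ∈ Metric.ball y₀ ρ := by
      have h1 := hnear _ (hξ i)
      rw [hnode] at h1
      have h2 := dist_triangle z (x i) y₀
      rw [dist_comm z (x i)] at h2
      have h3 : Cₙ * t ^ (p + 1) ≤ Cₙ * t := by gcongr
      rw [Metric.mem_ball]
      linarith
    have h1 := hF.lipschitz _ (hball _ (hξ i)) z hzρ
    rw [(hF.mem_iff z hzρ).1 hz, sub_zero, hnode] at h1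
    rw [Function.comp_apply, hnode, mul_assoc]
    exact h1.trans (by gcongr)
  have hFX : |F (X (t • ζ))| ≤ C₂ * t ^ (p + 1) := by
    have h1 := abs_le_of_nodal_bound hB hξ hBΛ (g := F ∘ X) ht.le hM' (by positivity)
      (fun ζ hζ => (hF.contDiffAt _ (hball ζ hζ)).comp (t • ζ) hX.contDiffAt)
      (fun ζ hζ => norm_iteratedFDeriv_comp_le_of_isOpen Metric.isOpen_ball hF.contDiffAt hX
        (hball ζ hζ) (fun i hi => hF.iteratedFDeriv_le i hi _ (hball ζ hζ))
        (fun i hi1 hi => (hsmooth i hi1 hi ζ hζ).trans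
          ((le_max_left M 1).trans (le_self_pow₀ hD1 (by omega))))) hFnode hζ
    refine h1.trans (le_of_eq ?_)
    simp only [C₂]
    ring
  have hFη : |F (X (t • ζ))| < η := by
    have h1 : C₂ * t ^ (p + 1) ≤ C₂ * t := by gcongr
    exact (hFX.trans h1).trans_lt (hsmall₂ t (htt.trans hle₂))
  have hXη : dist (X (t • ζ)) y₀ < η := by
    have := hnear ζ hζ
    linarith
  have hm₀η : dist m₀ m₀ < η := by rwa [dist_self]
  -- The point has height 0 over itself on its own level set. Moving to level 0 along `m₀` reaches
  -- `Γ` after a step of at most `L' * |F (X (t • ζ))|`.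
  have h0 := hψ.unique (X (t • ζ)) m₀ 0 hXη hm₀η (by rwa [abs_zero])
    (by rwa [zero_smul, add_zero])
  rw [zero_smul, add_zero] at h0
  have he : ((X (t • ζ), m₀, 0) : ChartParam) ∈ Metric.ball (y₀, m₀, (0 : ℝ)) η :=
    mem_ball_chartParam.2 ⟨hXη, hm₀η, by rwa [abs_zero]⟩
  refine ⟨X (t • ζ) + ψ (X (t • ζ), m₀, 0) • m₀, ?_, ?_⟩
  · rw [hF.mem_iff _ (hψ.mem_ball (X (t • ζ), m₀, 0) he)]
    exact hψ.apply_eq (X (t • ζ), m₀, 0) he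
  · rw [dist_self_add_right, norm_smul, hm₀, mul_one, Real.norm_eq_abs, mul_assoc]
    have h1 := hψ.lipschitz _ he (X (t • ζ), m₀, F (X (t • ζ)))
      (mem_ball_chartParam.2 ⟨hXη, hm₀η, hFη⟩)
    rw [h0, sub_zero] at h1
    refine h1.trans (mul_le_mul_of_nonneg_left ?_ hL'.le)
    simpa [Prod.dist_eq, Real.dist_eq] using hFX

end ParametricElements

/-! ### Arbitrary real constants and uniformity over the compact part -/

section Uniformity

variable {N : ℕ} {P : MeshPatch N} {Γ K : Set Space} {p : ℕ} {t : ℝ} {y : Fin N → Space}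

/-- The given constants may be negative; monotonicity lets their absolute values replace them. -/
theorem MeshPatch.IsAccurate.mono {Cx Cx' Cm Cm' : ℝ} (ht : 0 ≤ t) (hx : Cx ≤ Cx') (hm : Cm ≤ Cm')
    (h : P.IsAccurate Γ K p t Cx Cm y) : P.IsAccurate Γ K p t Cx' Cm' y := by
  refine ⟨fun i => ?_, h.2⟩
  obtain ⟨h1, h2, h3, ν, hν, h4⟩ := h.1 i
  exact ⟨h1, h2.trans (by gcongr), h3, ν, hν, h4.trans (by gcongr)⟩

theorem MeshPatch.NormalsAccurateOn.mono {Cn Cn' : ℝ} (ht : 0 ≤ t) (hn : Cn ≤ Cn')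
    {S : Finset (Fin N)} (h : P.NormalsAccurateOn Γ p t Cn y S) :
    P.NormalsAccurateOn Γ p t Cn' y S := fun i hi => by
  obtain ⟨ν, hν, h1⟩ := h i hi
  exact ⟨ν, hν, h1.trans (by gcongr)⟩

theorem LocalFit.IsLocal.mono {A : LocalFit p N} {R R' : ℝ} (ht : 0 ≤ t) (hR : R ≤ R')
    (h : A.IsLocal P t R) : A.IsLocal P t R' :=
  ⟨fun i hi => (h.1 i hi).trans (by gcongr), fun j => (h.2 j).trans (by gcongr)⟩

theorem WellConditioned.mono {s : ℝ≥0∞} [Fact (1 ≤ s)] {m n : Type} [Fintype m] [Fintype n]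
    [DecidableEq m] [DecidableEq n] {κ κ' : ℝ} (hκ : κ ≤ κ') {A : Matrix m n ℝ}
    (h : WellConditioned s κ A) : WellConditioned s κ' A :=
  ⟨h.1, h.2.trans hκ⟩

/-- The nodes are accurate, uniformly over the compact part `K` of the surface. -/
theorem exists_node_bound {n : ℕ} (hΓ : IsSurfaceOfClass (n + 2) Γ) (hK : IsCompact K)
    (hKΓ : K ⊆ Γ) (s : ℝ≥0∞) [Fact (1 ≤ s)] (R Cx Cm Cn κ : ℝ) :
    ∃ C t₀ : ℝ, 0 ≤ C ∧ 0 < t₀ ∧ ∀ t, 0 < t → t ≤ t₀ → ∀ (N : ℕ) (P : MeshPatch N)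
      (y : Fin N → Space) (ξ : Plane) (x : Space), P.IsAccurate Γ K (n + 1) t Cx Cm y →
      ξ ∈ refTriangle → IsReconstructedNode Γ s (n + 1) t R Cn κ P y ξ x →
      (∃ z ∈ Γ, dist x z ≤ C * t ^ (n + 2)) ∧ ∃ k ∈ K, dist x k ≤ C * t := by
  -- Compactness is applied to the surface point `k` assigned to the first corner of the triangle.
  obtain ⟨C, t₀, ht₀, hC⟩ := hK.exists_uniform_bound (Pr := fun k C t => ∀ (N : ℕ)
    (P : MeshPatch N) (y : Fin N → Space) (ξ : Plane) (A : LocalFit (n + 1) N),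
      P.IsAccurate Γ K (n + 1) t |Cx| |Cm| y → ξ ∈ refTriangle → A.IsLocal P t |R| →
      A.IsReconstruction Γ s t |Cn| |κ| P y ξ → y (P.tri 0) = k →
      (∃ z ∈ Γ, dist (A.projection P ξ) z ≤ C * t ^ (n + 2)) ∧
        dist (A.projection P ξ) k ≤ C * t)
    (by
      intro k C C' t ht hCC h N P y ξ A h1 h2 h3 h4 h5
      obtain ⟨⟨z, hz, h6⟩, h7⟩ := h N P y ξ A h1 h2 h3 h4 h5
      exact ⟨⟨z, hz, h6.trans (by gcongr)⟩, h7.trans (by gcongr)⟩)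
    (by
      intro y₀ hy₀
      obtain ⟨C, t₀, ht₀, h⟩ := exists_fit_bound_near hΓ hKΓ (hKΓ hy₀) (abs_nonneg R)
        (abs_nonneg Cx) (abs_nonneg Cm) (abs_nonneg Cn) (abs_nonneg κ) s
      refine ⟨C, t₀, ht₀, fun t ht htt k _ hk N P y ξ A h1 h2 h3 h4 h5 => ?_⟩
      subst h5
      exact h t ht htt N P y ξ A h1 h2 h3 h4 hk)
  -- `|Cx|` serves the nodes that are corners of the input triangle.
  refine ⟨max C |Cx|, min t₀ 1, le_max_of_le_right (abs_nonneg _), by positivity, ?_⟩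
  intro t ht htt N P y ξ x hacc hξ hx
  have htt₀ : t ≤ t₀ := htt.trans (min_le_left _ _)
  have hpow : t ^ (n + 2) ≤ t := by
    simpa using pow_le_pow_of_le_one ht.le (htt.trans (min_le_right _ _))
      (show 1 ≤ n + 2 by omega)
  have hacc' := hacc.mono ht.le (le_abs_self Cx) (le_abs_self Cm)
  have hfit : ∀ A : LocalFit (n + 1) N, A.IsLocal P t R →
      A.IsReconstruction Γ s t |Cn| |κ| P y ξ → x = A.projection P ξ →
      (∃ z ∈ Γ, dist x z ≤ max C |Cx| * t ^ (n + 2)) ∧ ∃ k ∈ K, dist x k ≤ max C |Cx| * t := by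
    rintro A hloc hrec rfl
    have hk := (hacc.1 (P.tri 0)).1
    obtain ⟨⟨z, hz, h1⟩, h2⟩ := hC t ht htt₀ (y (P.tri 0)) hk N P y ξ A hacc' hξ
      (hloc.mono ht.le (le_abs_self R)) hrec rfl
    exact ⟨⟨z, hz, h1.trans (by gcongr; exact le_max_left _ _)⟩, _, hk,
      h2.trans (by gcongr; exact le_max_left _ _)⟩
  rcases hx with ⟨j, rfl⟩ | ⟨A, hloc, hA, hc, hxA⟩ | ⟨A, hloc, hA, hc, hn, hxA⟩
  · obtain ⟨hyK, hd, -⟩ := hacc'.1 (P.tri j)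
    rw [← dist_eq_norm] at hd
    have hle : |Cx| * t ^ (n + 2) ≤ max C |Cx| * t ^ (n + 2) := by
      gcongr
      exact le_max_right _ _
    refine ⟨⟨_, hKΓ hyK, hd.trans hle⟩, _, hyK, hd.trans (hle.trans ?_)⟩
    exact mul_le_mul_of_nonneg_left hpow (le_max_of_le_right (abs_nonneg _))
  · exact hfit A hloc (Or.inl ⟨hA, hc.mono (le_abs_self κ)⟩) hxA
  · exact hfit A hloc (Or.inr ⟨hA, hc.mono (le_abs_self κ), hn.mono ht.le (le_abs_self Cn)⟩) hxA

end Uniformity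

theorem mainTheorem1 (p : ℕ) (hp : 1 ≤ p) (Γ K : Set Space) (hΓ : IsSurfaceOfClass (p + 1) Γ)
    (hK : IsCompact K) (hKΓ : K ⊆ Γ) (s : ℝ≥0∞) [Fact (1 ≤ s)] (R Cx Cm Cn κ Λ M : ℝ) :
    ∃ C h₀ : ℝ, 0 < h₀ ∧ ∀ h : ℝ, 0 < h → h ≤ h₀ →
      ∀ (N : ℕ) (P : MeshPatch N) (y : Fin N → Space) (ξ : Fin (numNodes p) → Plane)
        (B : Fin (numNodes p) → MvPolynomial (Fin 2) ℝ) (x : Fin (numNodes p) → Space),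
        P.IsAccurate Γ K p h Cx Cm y →
        (∀ i, ξ i ∈ refTriangle) →
        IsLagrangeBasis p ξ B →
        IsStable p B Λ →
        (∀ i, IsReconstructedNode Γ s p h R Cn κ P y (ξ i) (x i)) →
        IsSmoothToDegree (p + 1) h M (elementMap h B x) →
        ∀ ζ ∈ refTriangle, ∃ z ∈ Γ, dist (elementMap h B x (h • ζ)) z ≤ C * h ^ (p + 1) := by
  obtain ⟨n, rfl⟩ : ∃ n, p = n + 1 := ⟨p - 1, by omega⟩
  obtain ⟨C₁, t₁, hC₁, ht₁, hnode⟩ := exists_node_bound hΓ hK hKΓ s R Cx Cm Cn κ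
  obtain ⟨C₂, t₂, ht₂, helem⟩ := hK.exists_uniform_bound (Pr := fun k C t =>
    ∀ (ξ : Fin (numNodes (n + 1)) → Plane)
      (B : Fin (numNodes (n + 1)) → MvPolynomial (Fin 2) ℝ) (x : Fin (numNodes (n + 1)) → Space)
      (i₀ : Fin (numNodes (n + 1))), (∀ i, ξ i ∈ refTriangle) → IsLagrangeBasis (n + 1) ξ B →
      IsStable (n + 1) B |Λ| → (∀ i, ∃ z ∈ Γ, dist (x i) z ≤ C₁ * t ^ (n + 2)) →
      IsSmoothToDegree (n + 2) t |M| (elementMap t B x) → dist (x i₀) k ≤ C₁ * t →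
      ∀ ζ ∈ refTriangle, ∃ z ∈ Γ, dist (elementMap t B x (t • ζ)) z ≤ C * t ^ (n + 2))
    (by
      intro k C C' t ht hCC h ξ B x i₀ h1 h2 h3 h4 h5 h6 ζ hζ
      obtain ⟨z, hz, h7⟩ := h ξ B x i₀ h1 h2 h3 h4 h5 h6 ζ hζ
      exact ⟨z, hz, h7.trans (by gcongr)⟩)
    (by
      intro y₀ hy₀
      obtain ⟨C, t₀, ht₀, h⟩ := exists_element_bound_near (by omega) hΓ (hKΓ hy₀) hC₁
        (abs_nonneg Λ) (abs_nonneg M)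
      exact ⟨C, t₀, ht₀, fun t ht htt k _ hk ξ B x i₀ h1 h2 h3 h4 h5 h6 =>
        h t ht htt ξ B x i₀ k h1 h2 h3 h4 h5 h6 hk⟩)
  refine ⟨C₂, min t₁ t₂, lt_min ht₁ ht₂, ?_⟩
  intro t ht htt N P y ξ B x hacc hξ hB hΛ hx hsmooth
  have hx' := fun i => hnode t ht (htt.trans (min_le_left _ _)) N P y (ξ i) (x i) hacc (hξ i) (hx i)
  -- A single node suffices to locate the element near a point `k` of `K`, where the local element
  -- bound applies.
  have hpos : 0 < numNodes (n + 1) := Nat.div_pos (by nlinarith) two_pos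
  obtain ⟨k, hk, hdk⟩ := (hx' ⟨0, hpos⟩).2
  exact helem t ht (htt.trans (min_le_right _ _)) k hk ξ B x ⟨0, hpos⟩ hξ hB
    (fun η hη => (hΛ η hη).trans (le_abs_self Λ)) (fun i => (hx' i).1)
    (fun j hj1 hj η hη => (hsmooth j hj1 hj η hη).trans (le_abs_self M)) hdk
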